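/- Conventions. Let $V$ be a finite-dimensional complex vector space. A reflection in $V$ is an element $g\in GL(V)$ of finite order whose fixed-point subspace has dimension $\dim V-1$; a unitary reflection group in $V$ is a finite subgroup of $GL(V)$ generated by reflections. A reflection coset in $V$ is a coset $\gamma G$, where $G\subseteq GL(V)$ is a unitary reflection group and $\gamma\in GL(V)$ has finite order and satisfies $\gamma G=G\gamma$. For a complex root of unity $\zeta$ and $x\in GL(V)$ put $V(x,\zeta)=\{v\in V\mid xv=\zeta v\}$, and let $\mathcal S_\zeta^V(\gamma G)$ be the finite set $\{V(x,\zeta)\mid x\in\gamma G\}$, partially ordered by the reverse of inclusion. For a finite poset $P$, the length $l(P)$ is the maximum of $|C|-1$ over all chains $C$ of $P$, including $C=\emptyset$ (so $l(\emptyset)=-1$), and $\widetilde H_i(P,\mathbb Z)$ denotes the reduced simplicial homology of the simplicial complex of chains of $P$ (with $\widetilde H_{-1}(\emptyset,\mathbb Z)=\mathbb Z$). The link of a chain $C$ is $\mathrm{lk}_P(C)=\{z\in P\mid z\notin C,\ \{z\}\cup C\text{ is a chain}\}$. The poset $P$ is Cohen–Macaulay over $\mathbb Z$ if for every chain $C$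 of $P$, including $C=\emptyset$, one has $\widetilde H_i(\mathrm{lk}_P(C),\mathbb Z)=0$ for all $i\neq l(\mathrm{lk}_P(C))$. Lemma. Fix a complex root of unity $\zeta$. Suppose that $\mathcal S_\zeta^V(\gamma G)$ is Cohen–Macaulay over $\mathbb Z$ for all triples $(G,\gamma,V)$ such that $\gamma G$ is a reflection coset in the finite-dimensional complex vector space $V$ and $V$ is irreducible as a module for the group $\langle G,\gamma\rangle$ generated by $G$ and $\gamma$. Then $\mathcal S_\zeta^V(\gamma G)$ is Cohen–Macaulay over $\mathbb Z$ for all triples $(G,\gamma,V)$ such that $\gamma G$ is a reflection coset in the finite-dimensional complex vector space $V$. -/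

import Mathlib

open scoped Pointwise

universe u v

noncomputable section

namespace ReflectionCoset

/-! ### Order complex, reduced homology and Cohen-Macaulay posets -/

section PosetTopology

variable (A : Type v) [CommRing A] (P : Type u) [PartialOrder P]

/-- The free module on the chains of `P` with `k` elements. A chain with `k` elements is listed
increasingly, as an order embedding of `Fin k`. These are the simplicial chains of degree
`k - 1` of the order complex of `P`; the empty simplex (`k = 0`) is included, since we want the
augmented complex. -/
abbrev SimplicialChains (k : ℕ) : Type (max u v) := (Fin k ↪o P) →₀ A

variable {P} in
/-- The `j`-th face of a chain `x₀ < ⋯ < x_k`: omit `x_j`. -/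
def face {k : ℕ} (s : Fin (k + 1) ↪o P) (j : Fin (k + 1)) : Fin k ↪o P :=
  (Fin.succAboveOrderEmb j).trans s

/-- The simplicial boundary `x₀ < ⋯ < x_k ↦ ∑ j, (-1) ^ j (x₀ < ⋯ omit x_j ⋯ < x_k)`; in the
lowest case `k = 0` it is the augmentation. -/
def boundary (k : ℕ) : SimplicialChains A P (k + 1) →ₗ[A] SimplicialChains A P k :=
  Finsupp.linearCombination A fun s : Fin (k + 1) ↪o P =>
    ∑ j : Fin (k + 1), ((-1 : A) ^ (j : ℕ)) • Finsupp.single (face s j) (1 : A)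

theorem boundary_single (k : ℕ) (s : Fin (k + 1) ↪o P) :
    boundary A P k (Finsupp.single s 1) =
      ∑ j : Fin (k + 1), ((-1 : A) ^ (j : ℕ)) • Finsupp.single (face s j) (1 : A) := by
  simp [boundary]

theorem face_face {k : ℕ} (s : Fin (k + 2) ↪o P) (i : Fin (k + 2)) (j : Fin (k + 1)) :
    face (face s (i.succAbove j)) (j.predAbove i) = face (face s i) j := by
  ext x
  simp only [face, RelEmbedding.coe_trans, Function.comp_apply, Fin.succAboveOrderEmb_apply]
  rw [Fin.succAbove_succAbove_succAbove_predAbove]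

theorem boundary_comp_boundary (k : ℕ) : boundary A P k ∘ₗ boundary A P (k + 1) = 0 := by
  refine Finsupp.lhom_ext' fun s => LinearMap.ext_ring ?_
  simp only [LinearMap.comp_apply, Finsupp.lsingle_apply, LinearMap.zero_apply, boundary_single,
    map_sum, map_smul, Finset.smul_sum, smul_smul, ← pow_add]
  rw [← Fintype.sum_prod_type']
  refine Finset.sum_involution (fun x _ => (x.1.succAbove x.2, x.2.predAbove x.1)) ?_ ?_ ?_ ?_
  · rintro ⟨i, j⟩ -
    dsimp only
    rw [face_face, Fin.neg_one_pow_succAbove_add_predAbove, ← add_smul]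
    simp [pow_add]
  · rintro ⟨i, j⟩ - - h
    exact Fin.succAbove_ne i j (congrArg Prod.fst h)
  · intro x _
    exact Finset.mem_univ _
  · rintro ⟨i, j⟩ -
    simp [Fin.succAbove_succAbove_predAbove, Fin.predAbove_predAbove_succAbove]

open CategoryTheory

/-- The augmented simplicial chain complex of the order complex of `P`, with coefficients in `A`,
indexed by the number of vertices: the term at `k` has simplicial degree `k - 1`. -/
def augmentedComplex : ChainComplex (ModuleCat.{max u v} A) ℕ :=
  ChainComplex.of (fun k => ModuleCat.of A (SimplicialChains A P k))
    (fun k => ModuleCat.ofHom (boundary A P k))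
    (fun k => by
      rw [← ModuleCat.ofHom_comp, boundary_comp_boundary]
      rfl)

/-- The reduced simplicial homology of `P` in degree `k - 1`, that is, `H̃_{k-1}(P, A)`. -/
def reducedHomology (k : ℕ) : ModuleCat.{max u v} A := (augmentedComplex A P).homology k

/-- The length of a finite poset: the maximum of `|C| - 1` over its chains `C`. The empty chain
counts, so the empty poset has length `-1`. -/
def posetLength : ℤ :=
  ((sSup {m : ℕ | ∃ C : Finset P, IsChain (· ≤ ·) (C : Set P) ∧ C.card = m} : ℕ) : ℤ) - 1

variable {P} in
/-- The link of a chain `C` in `P`. -/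
def link (C : Set P) : Set P := {z | z ∉ C ∧ IsChain (· ≤ ·) (insert z C)}

/-- A finite poset `P` is Cohen-Macaulay over `A` if for every chain `C` of `P`, the empty one
included, the reduced homology of the link of `C` vanishes in every degree `i = k - 1` other than
the length of the link. (Below degree `-1` there is no homology.) -/
def IsCohenMacaulay [Finite P] : Prop :=
  ∀ C : Set P, IsChain (· ≤ ·) C → ∀ k : ℕ, (k : ℤ) - 1 ≠ posetLength (link C) →
    Limits.IsZero (reducedHomology A (link C) k)

end PosetTopology

/-! ### Reflection cosets and their posets of eigenspaces -/

section Eigenspaces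

variable {V : Type u} [AddCommGroup V] [Module ℂ V]

/-- The `ζ`-eigenspace `V(x, ζ)` of `x ∈ GL(V)`. -/
abbrev eigenspace (x : LinearMap.GeneralLinearGroup ℂ V) (ζ : ℂ) : Submodule ℂ V :=
  Module.End.eigenspace (x : Module.End ℂ V) ζ

/-- A reflection: an element of `GL(V)` of finite order that fixes a hyperplane pointwise and is
not the identity, i.e. whose fixed space has dimension `dim V - 1`. -/
def IsReflection (g : LinearMap.GeneralLinearGroup ℂ V) : Prop :=
  IsOfFinOrder g ∧ Module.finrank ℂ (eigenspace g 1) + 1 = Module.finrank ℂ V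

/-- A unitary reflection group: a finite subgroup of `GL(V)` generated by reflections. -/
structure IsUnitaryReflectionGroup (G : Subgroup (LinearMap.GeneralLinearGroup ℂ V)) : Prop where
  finite : Finite G
  generated : Subgroup.closure {g | g ∈ G ∧ IsReflection g} = G

/-- `γG` is a reflection coset: `G` is a unitary reflection group in `V`, and `γ` is a linear
transformation of `V` of finite order with `γG = Gγ`. -/
structure IsReflectionCoset (G : Subgroup (LinearMap.GeneralLinearGroup ℂ V))
    (γ : LinearMap.GeneralLinearGroup ℂ V) : Prop where
  isUnitaryReflectionGroup : IsUnitaryReflectionGroup G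
  isOfFinOrder : IsOfFinOrder γ
  coset_eq : γ • (G : Set (LinearMap.GeneralLinearGroup ℂ V)) = MulOpposite.op γ • (G : Set _)

/-- The set of eigenspaces `{V(x, ζ) ∣ x ∈ γG}`. -/
def eigenspaceSet (ζ : ℂ) (G : Subgroup (LinearMap.GeneralLinearGroup ℂ V))
    (γ : LinearMap.GeneralLinearGroup ℂ V) : Set (Submodule ℂ V) :=
  (fun x => eigenspace x ζ) '' (γ • (G : Set (LinearMap.GeneralLinearGroup ℂ V)))

/-- The poset `S_ζ^V(γG)`: the set `{V(x, ζ) ∣ x ∈ γG}` ordered by the reverse of inclusion. -/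
abbrev EigenspacePoset (ζ : ℂ) (G : Subgroup (LinearMap.GeneralLinearGroup ℂ V))
    (γ : LinearMap.GeneralLinearGroup ℂ V) : Type u :=
  (eigenspaceSet ζ G γ)ᵒᵈ

theorem IsReflectionCoset.finite_eigenspacePoset
    {G : Subgroup (LinearMap.GeneralLinearGroup ℂ V)} {γ : LinearMap.GeneralLinearGroup ℂ V}
    (h : IsReflectionCoset G γ) (ζ : ℂ) : Finite (EigenspacePoset ζ G γ) := by
  have : Finite G := h.isUnitaryReflectionGroup.finite
  have hG : (G : Set (LinearMap.GeneralLinearGroup ℂ V)).Finite := Set.toFinite _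
  exact ((hG.smul_set (a := γ)).image fun x => eigenspace x ζ).to_subtype

/-- The natural representation on `V` of the group `⟨G, γ⟩` generated by `G` and `γ`. -/
def naturalRepresentation (G : Subgroup (LinearMap.GeneralLinearGroup ℂ V))
    (γ : LinearMap.GeneralLinearGroup ℂ V) :
    Representation ℂ (G ⊔ Subgroup.zpowers γ : Subgroup (LinearMap.GeneralLinearGroup ℂ V)) V :=
  (Units.coeHom (Module.End ℂ V)).comp (Subgroup.subtype _)

end Eigenspaces

end ReflectionCoset

end

/-! Suppose `V` is nonzero and not irreducible under `⟨G, γ⟩`. By Maschke's theorem it splits as `σ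
⊕ τ` with both summands stable and proper. A reflection moves all vectors along one line, so it is
trivial on `σ` or on `τ` (`IsReflection.eq_or_eq`). Hence `G` acts as the full product of its
restrictions, which are again reflection groups, and the eigenspaces on `σ` and `τ` can be
prescribed independently. The poset of `V` is therefore the product of the posets of `σ` and `τ`
(`IsReflectionCoset.exists_orderIso`), and induction on `dim V` leaves a statement about products of
posets.

A product of Cohen-Macaulay posets need not be Cohen-Macaulay, but it is when both factors have a
greatest element (`IsCohenMacaulay.of_orderIso_prod`). Here there is one: an eigenspace `V(γg, ζ)`
of least dimension is fixed pointwise by `G`, hence contained in all the others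
(`IsReflectionCoset.exists_isTop`). With a greatest element, being Cohen-Macaulay amounts to
sphericity of all open intervals `(x, y)`, where `x` may be `⊥`: a link either has a greatest
element or is an ordinal sum of such intervals. An open interval of a product is, up to homotopy,
the join of the intervals of the factors or the suspension of that join.

Joins are treated algebraically. Chains are lists graded by number of vertices, so a join
corresponds to a tensor product without degree shift, and `tensor_exact` adds the exactness ranges
of the factors. `exactAt_puncturedProduct` transfers this to products by Eilenberg-Zilber shuffles
and acyclic carriers; `exactAt_of_cover` gives the suspension. -/

noncomputable section

namespace ReflectionCoset

/-! ### The complex of all lists -/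

section ListComplex

variable {A : Type*} [CommRing A] {P : Type*}

/-- The free module on the lists with entries in `P`. -/
abbrev ListModule (A : Type*) [CommRing A] (P : Type*) := List P →₀ A

/-- Prepending an entry to all lists. -/
def consMap (a : P) : ListModule A P →ₗ[A] ListModule A P := Finsupp.lmapDomain A A (List.cons a)

@[simp] theorem consMap_single (a : P) (l : List P) (n : A) :
    consMap a (Finsupp.single l n) = Finsupp.single (a :: l) n := by
  simp [consMap]

/-- The alternating sum of the faces of a list. -/
def listBoundary : List P → ListModule A P
  | [] => 0
  | a :: l => Finsupp.single l (1 : A) - consMap a (listBoundary l)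

/-- The boundary map on lists. -/
def del : ListModule A P →ₗ[A] ListModule A P := Finsupp.linearCombination A listBoundary

@[simp] theorem del_single (l : List P) : del (Finsupp.single l (1 : A)) = listBoundary l := by
  simp [del]

theorem ListModule.hom_ext {N : Type*} [AddCommMonoid N] [Module A N] {f g : ListModule A P →ₗ[A] N}
    (h : ∀ l, f (Finsupp.single l (1 : A)) = g (Finsupp.single l (1 : A))) : f = g :=
  Finsupp.lhom_ext' fun l => LinearMap.ext_ring (h l)

/-- Prepending `a` is a contracting homotopy of the complex of all lists; every cone argument below
rests on this identity. -/
theorem del_consMap (a : P) (u : ListModule A P) :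
    del (consMap a u) = u - consMap a (del u) := by
  have : del ∘ₗ consMap (A := A) a = LinearMap.id - consMap a ∘ₗ del :=
    ListModule.hom_ext fun l => by simp [listBoundary]
  exact LinearMap.congr_fun this u

@[simp] theorem listBoundary_nil : (listBoundary [] : ListModule A P) = 0 := rfl

theorem listBoundary_cons (a : P) (l : List P) :
    (listBoundary (a :: l) : ListModule A P) =
    Finsupp.single l (1 : A) - consMap a (listBoundary l) := rfl

theorem del_listBoundary (l : List P) : del (listBoundary l : ListModule A P) = 0 := by
  induction l with
  | nil => simp
  | cons a l ih => simp [listBoundary_cons, del_consMap, ih]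

@[simp] theorem del_del (u : ListModule A P) : del (del u) = 0 := by
  have : del ∘ₗ del = (0 : ListModule A P →ₗ[A] ListModule A P) :=
    ListModule.hom_ext fun l => by simp [del_listBoundary]
  exact LinearMap.congr_fun this u

/-- The sign `(-1) ^ k` on lists of length `k`. -/
def signMap : ListModule A P →ₗ[A] ListModule A P :=
  Finsupp.linearCombination A fun l => Finsupp.single l ((-1) ^ l.length)

@[simp] theorem signMap_single (l : List P) :
    signMap (Finsupp.single l (1 : A)) = (-1 : A) ^ l.length • Finsupp.single l (1 : A) := by
  simp [signMap]

theorem signMap_consMap (a : P) (u : ListModule A P) :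
    signMap (consMap a u) = - consMap a (signMap u) := by
  have : signMap ∘ₗ consMap a = - (consMap a ∘ₗ signMap : ListModule A P →ₗ[A] ListModule A P) :=
    ListModule.hom_ext fun l => by simp [pow_succ]
  exact LinearMap.congr_fun this u

theorem signMap_listBoundary (l : List P) :
    signMap (listBoundary l : ListModule A P) = - del (signMap (Finsupp.single l (1 : A))) := by
  induction l with
  | nil => simp
  | cons a l ih =>
    have h : Finsupp.single (a :: l) (1 : A) = consMap a (Finsupp.single l (1 : A)) := by simp
    rw [h, signMap_consMap, map_neg, del_consMap, listBoundary_cons, map_sub, signMap_consMap, ih]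
    simp

theorem signMap_del (u : ListModule A P) : signMap (del u) = - del (signMap u) := by
  have : signMap ∘ₗ del = - (del ∘ₗ signMap : ListModule A P →ₗ[A] ListModule A P) :=
    ListModule.hom_ext fun l => by
      simpa using signMap_listBoundary (A := A) l
  exact LinearMap.congr_fun this u

/-! ### Chains and exactness -/

/-- `l` is a list of length `k` with entries in `S`, any two of which are related by `r`. -/
structure IsChainList (r : P → P → Prop) (S : Set P) (k : ℕ) (l : List P) : Prop where
  length_eq : l.length = k
  pairwise : l.Pairwise r
  mem : ∀ x ∈ l, x ∈ S

variable {r : P → P → Prop} {S T : Set P} {k : ℕ}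

/-- The tail lives in a smaller set than the list, which is why inductions on lists let `S` vary. -/
theorem isChainList_cons {a : P} {l : List P} :
    IsChainList r S (k + 1) (a :: l) ↔ a ∈ S ∧ IsChainList r (S ∩ {x | r a x}) k l := by
  constructor
  · rintro ⟨h1, h2, h3⟩
    rw [List.pairwise_cons] at h2
    refine ⟨h3 a (by simp), by simpa using h1, h2.2, fun x hx => ⟨h3 x (by simp [hx]), h2.1 x hx⟩⟩
  · rintro ⟨h, h1, h2, h3⟩
    refine ⟨by simp [h1], List.pairwise_cons.2 ⟨fun x hx => (h3 x hx).2, h2⟩, ?_⟩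
    intro x hx
    rcases List.mem_cons.1 hx with rfl | hx
    · exact h
    · exact (h3 x hx).1

theorem isChainList_nil : IsChainList r S 0 [] := ⟨rfl, List.Pairwise.nil, by simp⟩

theorem IsChainList.mono {l : List P} (h : IsChainList r S k l) (hST : S ⊆ T) :
    IsChainList r T k l := ⟨h.1, h.2, fun x hx => hST (h.3 x hx)⟩

/-- The span of the lists of length `k` with entries in `S`, any two of which are related by `r`. -/
def chains (A : Type*) [CommRing A] (r : P → P → Prop) (S : Set P) (k : ℕ) :
    Submodule A (ListModule A P) :=
  Submodule.span A {u | ∃ l, IsChainList r S k l ∧ u = Finsupp.single l (1 : A)}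

theorem single_mem_chains {l : List P} (h : IsChainList r S k l) :
    Finsupp.single l (1 : A) ∈ chains A r S k := Submodule.subset_span ⟨l, h, rfl⟩

theorem map_mem_of_chains {N : Type*} [AddCommMonoid N] [Module A N] {f : ListModule A P →ₗ[A] N}
    {B : Submodule A N} (h : ∀ l, IsChainList r S k l → f (Finsupp.single l (1 : A)) ∈ B)
    {u : ListModule A P} (hu : u ∈ chains A r S k) : f u ∈ B := by
  have : chains A r S k ≤ B.comap f := by
    rw [chains, Submodule.span_le]
    rintro _ ⟨l, hl, rfl⟩
    exact h l hl
  exact this hu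

theorem eq_of_chains {N : Type*} [AddCommMonoid N] [Module A N] {f g : ListModule A P →ₗ[A] N}
    (h : ∀ l, IsChainList r S k l → f (Finsupp.single l (1 : A)) = g (Finsupp.single l (1 : A)))
    {u : ListModule A P} (hu : u ∈ chains A r S k) : f u = g u := by
  refine LinearMap.eqOn_span ?_ hu
  rintro _ ⟨l, hl, rfl⟩
  exact h l hl

theorem chains_mono (hST : S ⊆ T) : chains A r S k ≤ chains A r T k :=
  fun _ hu => map_mem_of_chains (f := LinearMap.id)
    (fun _ hl => single_mem_chains (hl.mono hST)) hu

theorem consMap_mem_chains {a : P} (ha : a ∈ S) {u : ListModule A P}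
    (hu : u ∈ chains A r (S ∩ {x | r a x}) k) : consMap a u ∈ chains A r S (k + 1) :=
  map_mem_of_chains (fun l hl => by
    rw [consMap_single]; exact single_mem_chains (isChainList_cons.2 ⟨ha, hl⟩)) hu

theorem listBoundary_mem_chains {l : List P} (h : IsChainList r S (k + 1) l) :
    listBoundary l ∈ chains A r S k := by
  induction l generalizing S k with
  | nil => simp
  | cons a l ih =>
    obtain ⟨ha, hl⟩ := isChainList_cons.1 h
    rw [listBoundary_cons]
    refine sub_mem (single_mem_chains (hl.mono Set.inter_subset_left)) ?_
    cases k with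
    | zero =>
      have := List.length_eq_zero_iff.1 hl.length_eq
      simp [this]
    | succ k => exact consMap_mem_chains ha (ih hl)

theorem del_mem_chains {u : ListModule A P} (h : u ∈ chains A r S (k + 1)) :
    del u ∈ chains A r S k :=
  map_mem_of_chains (fun l hl => by rw [del_single]; exact listBoundary_mem_chains hl) h

theorem isChainList_zero {l : List P} : IsChainList r S 0 l ↔ l = [] :=
  ⟨fun h => List.length_eq_zero_iff.1 h.1, fun h => h ▸ isChainList_nil⟩

theorem del_eq_zero_of_mem_chains_zero {u : ListModule A P} (h : u ∈ chains A r S 0) : del u = 0 :=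
  eq_of_chains (g := 0) (fun l hl => by simp [isChainList_zero.1 hl]) h

theorem signMap_eq {u : ListModule A P} (h : u ∈ chains A r S k) :
    signMap u = (-1 : A) ^ k • u :=
  eq_of_chains (f := signMap) (g := (-1 : A) ^ k • LinearMap.id)
    (fun l hl => by rw [signMap_single, hl.length_eq]; rfl) h

/-- Exactness of the complex of chains in `S` at the chains with `k` entries. -/
def ExactAt (A : Type*) [CommRing A] (r : P → P → Prop) (S : Set P) (k : ℕ) : Prop :=
  ∀ z ∈ chains A r S k, del z = 0 → ∃ w ∈ chains A r S (k + 1), del w = z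

/-! ### Contractions -/

/-- Chain modules are free on lists, so fillings may be chosen on lists and extended linearly: `H l`
fills the cycle `l - H (∂l)`. This works over any ring and keeps Tor terms out of the Künneth
argument. -/
theorem exists_contraction {n : ℕ} (h : ∀ k < n, ExactAt A r S k) :
    ∃ H : ListModule A P →ₗ[A] ListModule A P,
        (∀ k, ∀ u ∈ chains A r S k, H u ∈ chains A r S (k + 1)) ∧
      ∀ k < n, ∀ u ∈ chains A r S k, del (H u) + H (del u) = u := by
  classical
  -- The default filling is `0`, so the choice is total and always lands in the chains.
  have step (k : ℕ) : ∀ z : ListModule A P, ∃ w ∈ chains A r S (k + 1),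
      (k < n → z ∈ chains A r S k → del z = 0 → del w = z) := by
    intro z
    by_cases hz : k < n ∧ z ∈ chains A r S k ∧ del z = 0
    · obtain ⟨w, hw, e⟩ := h k hz.1 z hz.2.1 hz.2.2
      exact ⟨w, hw, fun _ _ _ => e⟩
    · exact ⟨0, zero_mem _, fun a b c => (hz ⟨a, b, c⟩).elim⟩
  choose w hw hdw using step
  let F : ℕ → (ListModule A P →ₗ[A] ListModule A P) := fun k => Nat.rec
    (Finsupp.linearCombination A fun l => w 0 (Finsupp.single l (1 : A)))
    (fun k Hk => Finsupp.linearCombination A fun l =>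
      w (k + 1) (Finsupp.single l (1 : A) - Hk (listBoundary l))) k
  have F0 (l : List P) : F 0 (Finsupp.single l (1 : A)) = w 0 (Finsupp.single l (1 : A)) := by
    simp [F]
  have Fs (k : ℕ) (l : List P) : F (k + 1) (Finsupp.single l (1 : A)) =
      w (k + 1) (Finsupp.single l (1 : A) - F k (listBoundary l)) := by simp [F]
  have Fmem (k : ℕ) (l : List P) : F k (Finsupp.single l (1 : A)) ∈ chains A r S (k + 1) := by
    cases k with
    | zero => rw [F0]; exact hw _ _
    | succ k => rw [Fs]; exact hw _ _
  have Fmem' (k : ℕ) {u} (hu : u ∈ chains A r S k) : F k u ∈ chains A r S (k + 1) :=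
    map_mem_of_chains (fun l _ => Fmem k l) hu
  have F0d (h0 : 0 < n) : ∀ u ∈ chains A r S 0, del (F 0 u) = u := fun u hu =>
    eq_of_chains (f := del ∘ₗ F 0) (g := LinearMap.id) (fun l hl => by
      simp only [LinearMap.comp_apply, F0, LinearMap.id_apply]
      refine hdw 0 _ h0 (single_mem_chains hl) ?_
      simp [isChainList_zero.1 hl]) hu
  have Fsd (k : ℕ) : k + 1 < n → ∀ u ∈ chains A r S (k + 1),
      del (F (k + 1) u) + F k (del u) = u := by
    induction k with
    | zero =>
      intro hk u hu
      refine eq_of_chains (f := del ∘ₗ F 1 + F 0 ∘ₗ del) (g := LinearMap.id) (fun l hl => ?_) hu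
      have hb := listBoundary_mem_chains (A := A) hl
      simp only [LinearMap.add_apply, LinearMap.comp_apply, Fs, LinearMap.id_apply, del_single]
      rw [hdw 1 _ hk (sub_mem (single_mem_chains hl) (Fmem' _ hb))
        (by rw [map_sub, F0d (by omega) _ hb, del_single, sub_self])]
      abel
    | succ k ih =>
      intro hk u hu
      refine eq_of_chains (f := del ∘ₗ F (k + 2) + F (k + 1) ∘ₗ del) (g := LinearMap.id)
        (fun l hl => ?_) hu
      have hb := listBoundary_mem_chains (A := A) hl
      simp only [LinearMap.add_apply, LinearMap.comp_apply, Fs, LinearMap.id_apply, del_single]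
      rw [hdw (k + 2) _ hk (sub_mem (single_mem_chains hl) (Fmem' _ hb)) ?_]
      · abel
      · have := ih (by omega) _ hb
        rw [del_listBoundary, map_zero, add_zero] at this
        rw [map_sub, this, del_single, sub_self]
  -- The maps `F k` are glued into one map by reading the degree off the length of the list.
  refine ⟨Finsupp.linearCombination A fun l => F l.length (Finsupp.single l (1 : A)), ?_, ?_⟩
  · intro k u hu
    refine map_mem_of_chains (fun l hl => ?_) hu
    simpa [hl.length_eq] using Fmem k l
  · have key (k : ℕ) : ∀ u ∈ chains A r S k, Finsupp.linearCombination A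
        (fun l => F l.length (Finsupp.single l (1 : A))) u = F k u := fun u hu =>
      eq_of_chains (fun l hl => by simp [hl.length_eq]) hu
    intro k hk u hu
    cases k with
    | zero => rw [key 0 u hu, F0d hk u hu, del_eq_zero_of_mem_chains_zero hu]; simp
    | succ k => rw [key _ u hu, key _ _ (del_mem_chains hu), Fsd k hk u hu]

end ListComplex

/-! ### Carried chain endomorphisms are homotopic to the identity -/

section Preorder

variable {A : Type*} [CommRing A] {P : Type*} [Preorder P] {S : Set P}

/-- Acyclic carriers: the part of `S` above `x` is a cone with apex `x`, and `e` preserves it, so a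
homotopy from `e` to the identity can be built by coning off. Weakly increasing chains are
essential, since the apex is prepended to lists that may already begin with it. -/
theorem sub_mem_boundaries_of_carried (e : ListModule A P →ₗ[A] ListModule A P)
    (e_nil : e (Finsupp.single [] (1 : A)) = Finsupp.single [] (1 : A))
    (e_mem : ∀ x ∈ S, ∀ k, ∀ u ∈ chains A (· ≤ ·) (S ∩ {y | x ≤ y}) k,
      e u ∈ chains A (· ≤ ·) (S ∩ {y | x ≤ y}) k)
    (e_del : ∀ k, ∀ u ∈ chains A (· ≤ ·) S k, del (e u) = e (del u))
    {k : ℕ} {z : ListModule A P} (hz : z ∈ chains A (· ≤ ·) S k) (hdz : del z = 0) :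
    ∃ w ∈ chains A (· ≤ ·) S (k + 1), del w = z - e z := by
  let cone : List P → ListModule A P → ListModule A P := fun l u => match l with
    | [] => 0
    | a :: _ => consMap a u
  -- The cone over `l - e l - H (∂l)` has the first, hence least, entry of `l` as apex. The
  -- recursion starts at `0` because `e` fixes the empty list.
  let H : ℕ → (ListModule A P →ₗ[A] ListModule A P) := fun k => Nat.rec 0
    (fun k Hk => Finsupp.linearCombination A fun l =>
      cone l (Finsupp.single l (1 : A) - e (Finsupp.single l (1 : A)) - Hk (listBoundary l))) k
  have Hs (k : ℕ) (a : P) (l : List P) : H (k + 1) (Finsupp.single (a :: l) (1 : A)) =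
      consMap a (Finsupp.single (a :: l) (1 : A) - e (Finsupp.single (a :: l) (1 : A)) -
        H k (listBoundary (a :: l))) := by simp [H, cone]
  have up {a : P} {k : ℕ} {l : List P} (h : IsChainList (· ≤ ·) S (k + 1) (a :: l)) :
      a ∈ S ∧ IsChainList (· ≤ ·) (S ∩ {y | a ≤ y}) (k + 1) (a :: l) := by
    have h' := isChainList_cons.1 h
    refine ⟨h'.1, isChainList_cons.2 ⟨⟨h'.1, le_rfl⟩, h'.2.mono fun x hx => ⟨hx, hx.2⟩⟩⟩
  have Hmem (k : ℕ) : ∀ x ∈ S, ∀ u ∈ chains A (· ≤ ·) (S ∩ {y | x ≤ y}) k,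
      H k u ∈ chains A (· ≤ ·) (S ∩ {y | x ≤ y}) (k + 1) := by
    induction k with
    | zero => intro x _ u _; exact zero_mem _
    | succ k ih =>
      intro x hx u hu
      refine map_mem_of_chains (fun l hl => ?_) hu
      cases l with
      | nil => simpa using hl.length_eq
      | cons a l =>
        have hxa := (isChainList_cons.1 hl).1
        obtain ⟨haS, hal⟩ := up (hl.mono Set.inter_subset_left)
        rw [Hs]
        refine consMap_mem_chains hxa (chains_mono (S := S ∩ {y | a ≤ y}) ?_ ?_)
        · exact fun y hy => ⟨⟨hy.1, hxa.2.trans hy.2⟩, hy.2⟩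
        · exact sub_mem (sub_mem (single_mem_chains hal) (e_mem a haS _ _ (single_mem_chains hal)))
            (ih a haS _ (listBoundary_mem_chains hal))
  have Hmem' (k : ℕ) : ∀ u ∈ chains A (· ≤ ·) S k, H k u ∈ chains A (· ≤ ·) S (k + 1) := by
    intro u hu
    refine map_mem_of_chains (fun l hl => ?_) hu
    cases l with
    | nil =>
      have : k = 0 := by simpa using hl.length_eq.symm
      subst this
      exact zero_mem _
    | cons a l =>
      obtain ⟨k, rfl⟩ : ∃ j, k = j + 1 := ⟨l.length, by simpa using hl.length_eq.symm⟩
      obtain ⟨haS, hal⟩ := up hl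
      exact chains_mono Set.inter_subset_left (Hmem _ a haS _ (single_mem_chains hal))
  have Hd (k : ℕ) : ∀ u ∈ chains A (· ≤ ·) S (k + 1),
      del (H (k + 1) u) + H k (del u) = u - e u := by
    induction k with
    | zero =>
      intro u hu
      refine eq_of_chains (f := del ∘ₗ H 1 + H 0 ∘ₗ del) (g := LinearMap.id - e)
        (fun l hl => ?_) hu
      obtain ⟨a, rfl⟩ := List.length_eq_one_iff.1 hl.length_eq
      have h1 := e_del _ _ (single_mem_chains hl)
      simp only [del_single, listBoundary_cons, listBoundary_nil, map_zero, sub_zero, e_nil] at h1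
      have h0 (u : ListModule A P) : H 0 u = 0 := rfl
      simp only [LinearMap.add_apply, LinearMap.comp_apply, LinearMap.sub_apply,
        LinearMap.id_apply, Hs, h0, del_consMap, map_sub, h1, del_single, listBoundary_cons,
        listBoundary_nil, map_zero]
      abel
    | succ k ih =>
      intro u hu
      refine eq_of_chains (f := del ∘ₗ H (k + 2) + H (k + 1) ∘ₗ del) (g := LinearMap.id - e)
        (fun l hl => ?_) hu
      cases l with
      | nil => simpa using hl.length_eq
      | cons a l =>
        have h1 := e_del _ _ (single_mem_chains hl)
        have h2 := ih _ (listBoundary_mem_chains hl)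
        simp only [del_listBoundary, map_zero, add_zero] at h2
        simp only [LinearMap.add_apply, LinearMap.comp_apply, LinearMap.sub_apply,
          LinearMap.id_apply, Hs, del_consMap, map_sub, h1, h2, del_single]
        abel_nf
  refine ⟨H k z, Hmem' k z hz, ?_⟩
  cases k with
  | zero =>
    have : z - e z = 0 := by
      refine eq_of_chains (f := LinearMap.id - e) (g := 0) (fun l hl => ?_) hz
      simp [isChainList_zero.1 hl, e_nil]
    simp [H, this]
  | succ k => simpa [hdz] using Hd k z hz

end Preorder

/-! ### Weakly and strictly increasing chains -/

section PartialOrder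

variable {A : Type*} [CommRing A] {P : Type*}

open Classical in
/-- Prepending an entry to all lists that do not start with it; the other lists are killed. -/
def strictConsMap (a : P) : ListModule A P →ₗ[A] ListModule A P :=
  Finsupp.linearCombination A fun l =>
    if l.head? = some a then 0 else Finsupp.single (a :: l) (1 : A)

@[simp] theorem strictConsMap_self (a : P) (l : List P) :
    strictConsMap a (Finsupp.single (a :: l) (1 : A)) = 0 := by
  simp [strictConsMap]

theorem strictConsMap_consMap (a : P) (u : ListModule A P) : strictConsMap a (consMap a u) = 0 := by
  have : strictConsMap a ∘ₗ consMap (A := A) a = 0 := ListModule.hom_ext fun l => by simp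
  exact LinearMap.congr_fun this u

/-- The image of a list in the quotient by lists with repetitions, for increasing lists. -/
def normalizeList : List P → ListModule A P
  | [] => Finsupp.single [] (1 : A)
  | a :: l => strictConsMap a (normalizeList l)

/-- Killing the increasing lists with repetitions. -/
def normalize : ListModule A P →ₗ[A] ListModule A P := Finsupp.linearCombination A normalizeList

@[simp] theorem normalize_single (l : List P) :
    normalize (Finsupp.single l (1 : A)) = normalizeList l := by simp [normalize]

theorem normalize_consMap (a : P) (u : ListModule A P) :
    normalize (consMap a u) = strictConsMap a (normalize u) := by
  have : normalize ∘ₗ consMap (A := A) a = strictConsMap a ∘ₗ normalize :=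
    ListModule.hom_ext fun l => by simp [normalizeList]
  exact LinearMap.congr_fun this u

variable [PartialOrder P] {S : Set P}

theorem strictConsMap_of_lt {a : P} {l : List P} (h : ∀ x ∈ l, a < x) :
    strictConsMap a (Finsupp.single l (1 : A)) = Finsupp.single (a :: l) (1 : A) := by
  cases l with
  | nil => simp [strictConsMap]
  | cons b l =>
    have : b ≠ a := (h b (by simp)).ne'
    simp [strictConsMap, this]

theorem isChainList_lt_cases {a : P} {k : ℕ} {l : List P}
    (h : IsChainList (· < ·) (S ∩ {x | a ≤ x}) k l) :
    (IsChainList (· < ·) (S ∩ {x | a < x}) k l) ∨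
      ∃ l', l = a :: l' ∧ ∀ x ∈ l', a < x := by
  cases l with
  | nil => left; exact ⟨h.1, h.2, by simp⟩
  | cons b l =>
    have hp := (List.pairwise_cons.1 h.pairwise).1
    rcases (h.mem b (by simp)).2.eq_or_lt with rfl | hb
    · exact Or.inr ⟨l, rfl, hp⟩
    · refine Or.inl ⟨h.1, h.2, fun x hx => ⟨(h.mem x hx).1, ?_⟩⟩
      rcases List.mem_cons.1 hx with rfl | hx
      · exact hb
      · exact hb.trans (hp x hx)

theorem strictConsMap_mem_chains {a : P} (ha : a ∈ S) {k : ℕ} {u : ListModule A P}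
    (hu : u ∈ chains A (· < ·) (S ∩ {x | a ≤ x}) k) :
    strictConsMap a u ∈ chains A (· < ·) (S ∩ {x | a ≤ x}) (k + 1) := by
  refine map_mem_of_chains (fun l hl => ?_) hu
  rcases isChainList_lt_cases hl with h | ⟨l', rfl, -⟩
  · rw [strictConsMap_of_lt fun x hx => (h.mem x hx).2]
    exact single_mem_chains (isChainList_cons.2 ⟨⟨ha, le_rfl⟩, h.mono fun x hx =>
      ⟨⟨hx.1, hx.2.le⟩, hx.2⟩⟩)
  · simp

theorem strictConsMap_eq_consMap {a : P} {k : ℕ} {u : ListModule A P}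
    (hu : u ∈ chains A (· < ·) (S ∩ {x | a < x}) k) : strictConsMap a u = consMap a u :=
  eq_of_chains (fun l hl => by
    rw [strictConsMap_of_lt fun x hx => (hl.mem x hx).2, consMap_single]) hu

theorem listBoundary_mem_chains_pred {a : P} {k : ℕ} {l : List P}
    (hl : IsChainList (· < ·) (S ∩ {x | a < x}) k l) :
    listBoundary l ∈ chains A (· < ·) (S ∩ {x | a < x}) (k - 1) := by
  cases k with
  | zero => simp [isChainList_zero.1 hl]
  | succ k => exact listBoundary_mem_chains hl

/-- If `l` starts with `a`, the left side is zero; on the right `l` cancels against the term coming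
from its face without `a`, and the other faces start with `a` and are killed. -/
theorem del_strictConsMap {a : P} {k : ℕ} {u : ListModule A P}
    (hu : u ∈ chains A (· < ·) (S ∩ {x | a ≤ x}) k) :
    del (strictConsMap a u) = u - strictConsMap a (del u) := by
  refine eq_of_chains (f := del ∘ₗ strictConsMap a) (g := LinearMap.id - strictConsMap a ∘ₗ del)
    (fun l hl => ?_) hu
  rcases isChainList_lt_cases hl with h | ⟨l', rfl, h'⟩
  · simp only [LinearMap.comp_apply, LinearMap.sub_apply, LinearMap.id_apply, del_single]
    rw [strictConsMap_eq_consMap (single_mem_chains h),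
      strictConsMap_eq_consMap (listBoundary_mem_chains_pred h), del_consMap, del_single]
  · simp [listBoundary_cons, strictConsMap_consMap, strictConsMap_of_lt h']

theorem normalizeList_mem {k : ℕ} {l : List P} (h : IsChainList (· ≤ ·) S k l) :
    normalizeList l ∈ chains A (· < ·) S k := by
  induction l generalizing S k with
  | nil => exact single_mem_chains ⟨h.1, List.Pairwise.nil, by simp⟩
  | cons a l ih =>
    obtain ⟨k, rfl⟩ : ∃ j, k = j + 1 := ⟨l.length, by simpa using h.length_eq.symm⟩
    obtain ⟨ha, hl⟩ := isChainList_cons.1 h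
    exact chains_mono Set.inter_subset_left (strictConsMap_mem_chains ha (ih hl))

theorem normalize_mem {k : ℕ} {u : ListModule A P} (h : u ∈ chains A (· ≤ ·) S k) :
    normalize u ∈ chains A (· < ·) S k :=
  map_mem_of_chains (fun l hl => by rw [normalize_single]; exact normalizeList_mem hl) h

theorem normalizeList_eq {l : List P} (h : l.Pairwise (· < ·)) :
    normalizeList l = Finsupp.single l (1 : A) := by
  induction l with
  | nil => rfl
  | cons a l ih =>
    rw [List.pairwise_cons] at h
    rw [normalizeList, ih h.2, strictConsMap_of_lt h.1]

theorem normalize_eq {k : ℕ} {u : ListModule A P} (h : u ∈ chains A (· < ·) S k) :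
    normalize u = u :=
  eq_of_chains (g := LinearMap.id) (fun l hl => by
    rw [normalize_single, normalizeList_eq hl.pairwise, LinearMap.id_apply]) h

theorem del_normalizeList {k : ℕ} {l : List P} (h : IsChainList (· ≤ ·) S k l) :
    del (normalizeList l : ListModule A P) = normalize (listBoundary l) := by
  induction l generalizing S k with
  | nil => simp [normalizeList]
  | cons a l ih =>
    obtain ⟨k, rfl⟩ : ∃ j, k = j + 1 := ⟨l.length, by simpa using h.length_eq.symm⟩
    obtain ⟨ha, hl⟩ := isChainList_cons.1 h
    rw [normalizeList, del_strictConsMap (normalizeList_mem hl), ih hl, listBoundary_cons, map_sub,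
      normalize_consMap, normalize_single]

theorem del_normalize {k : ℕ} {u : ListModule A P} (h : u ∈ chains A (· ≤ ·) S k) :
    del (normalize u) = normalize (del u) :=
  eq_of_chains (f := del ∘ₗ normalize) (g := normalize ∘ₗ del)
    (fun l hl => by simpa using del_normalizeList hl) h

theorem chains_lt_le (S : Set P) (k : ℕ) : chains A (· < ·) S k ≤ chains A (· ≤ ·) S k :=
  fun _ hu => map_mem_of_chains (f := LinearMap.id) (fun _ hl => single_mem_chains
    ⟨hl.1, hl.2.imp le_of_lt, hl.3⟩) hu

/-- Normalization theorem: `normalize` is a chain map carried by upper sets, hence homotopic to the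
identity on weak chains, and it is the identity on strict chains. Weak chains are the convenient
ones, being stable under monotone maps and coning. -/
theorem exactAt_lt_iff {k : ℕ} : ExactAt A (· < ·) S k ↔ ExactAt A (· ≤ ·) S k := by
  constructor
  · intro h z hz hdz
    obtain ⟨w, hw, e⟩ :=
        h (normalize z) (normalize_mem hz) (by rw [del_normalize hz, hdz, map_zero])
    obtain ⟨w', hw', e'⟩ := sub_mem_boundaries_of_carried normalize (by simp [normalizeList])
      (fun _ _ k u hu => chains_lt_le _ k (normalize_mem hu))
        (fun k u hu => del_normalize hu) hz hdz
    exact ⟨w + w', add_mem (chains_lt_le _ _ hw) hw', by simp [e, e']⟩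
  · intro h z hz hdz
    obtain ⟨w, hw, e⟩ := h z (chains_lt_le _ _ hz) hdz
    exact ⟨normalize w, normalize_mem hw, by rw [del_normalize hw, e, normalize_eq hz]⟩

end PartialOrder

/-! ### Tensor products of chain complexes -/

section Tensor

open TensorProduct

variable {A : Type*} [CommRing A] {P Q R : Type*}

/-- The boundary map of the tensor product of two list complexes. -/
def tensorDel : ListModule A P ⊗[A] ListModule A Q →ₗ[A] ListModule A P ⊗[A] ListModule A Q :=
  TensorProduct.map del LinearMap.id + TensorProduct.map signMap del

@[simp] theorem tensorDel_tmul (u : ListModule A P) (v : ListModule A Q) :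
    tensorDel (u ⊗ₜ[A] v) = del u ⊗ₜ v + signMap u ⊗ₜ del v := by simp [tensorDel]

/-- Linear maps out of the tensor product agree if they agree on pairs of lists. -/
theorem tensor_hom_ext {N : Type*} [AddCommMonoid N] [Module A N]
    {f g : ListModule A P ⊗[A] ListModule A Q →ₗ[A] N}
    (h : ∀ l m, f (Finsupp.single l (1 : A) ⊗ₜ Finsupp.single m (1 : A)) =
      g (Finsupp.single l (1 : A) ⊗ₜ Finsupp.single m (1 : A))) : f = g :=
  TensorProduct.ext (ListModule.hom_ext fun l => ListModule.hom_ext fun m => by simpa using h l m)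

section Preorder

variable [Preorder P] [Preorder Q] {S : Set P} {T : Set Q}

/-- The span of the tensors of weakly increasing lists in `S` and `T` of total length `k`. -/
def tensorChains (A : Type*) [CommRing A] (S : Set P) (T : Set Q) (k : ℕ) :
    Submodule A (ListModule A P ⊗[A] ListModule A Q) :=
  Submodule.span A {w | ∃ l m, ∃ i j, i + j = k ∧ IsChainList (· ≤ ·) S i l ∧
    IsChainList (· ≤ ·) T j m ∧ w = Finsupp.single l (1 : A) ⊗ₜ Finsupp.single m (1 : A)}

theorem map_mem_of_tensorChains {N : Type*} [AddCommMonoid N] [Module A N]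
    {f : ListModule A P ⊗[A] ListModule A Q →ₗ[A] N} {B : Submodule A N} {k : ℕ}
    (h : ∀ i j l m, i + j = k → IsChainList (· ≤ ·) S i l → IsChainList (· ≤ ·) T j m →
      f (Finsupp.single l (1 : A) ⊗ₜ Finsupp.single m (1 : A)) ∈ B)
    {w : ListModule A P ⊗[A] ListModule A Q} (hw : w ∈ tensorChains A S T k) : f w ∈ B := by
  have : tensorChains A S T k ≤ B.comap f := by
    rw [tensorChains, Submodule.span_le]
    rintro _ ⟨l, m, i, j, hij, hl, hm, rfl⟩
    exact h i j l m hij hl hm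
  exact this hw

theorem tmul_mem_tensorChains {i j k : ℕ} (hk : i + j = k) {u : ListModule A P} {v : ListModule A Q}
    (hu : u ∈ chains A (· ≤ ·) S i) (hv : v ∈ chains A (· ≤ ·) T j) :
    u ⊗ₜ[A] v ∈ tensorChains A S T k := by
  refine map_mem_of_chains (f := (TensorProduct.mk A _ _).flip v) (fun l hl => ?_) hu
  refine map_mem_of_chains (f := TensorProduct.mk A _ _ (Finsupp.single l (1 : A)))
      (fun m hm => ?_) hv
  exact Submodule.subset_span ⟨l, m, i, j, hk, hl, hm, rfl⟩

theorem eq_of_tensorChains {N : Type*} [AddCommMonoid N] [Module A N]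
    {f g : ListModule A P ⊗[A] ListModule A Q →ₗ[A] N} {k : ℕ}
    (h : ∀ i j l m, i + j = k → IsChainList (· ≤ ·) S i l → IsChainList (· ≤ ·) T j m →
      f (Finsupp.single l (1 : A) ⊗ₜ Finsupp.single m (1 : A)) =
          g (Finsupp.single l (1 : A) ⊗ₜ Finsupp.single m (1 : A)))
    {w : ListModule A P ⊗[A] ListModule A Q} (hw : w ∈ tensorChains A S T k) : f w = g w := by
  refine LinearMap.eqOn_span ?_ hw
  rintro _ ⟨l, m, i, j, hij, hl, hm, rfl⟩
  exact h i j l m hij hl hm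

/-- The Künneth theorem, in the form of an exactness range. -/
theorem tensor_exact {a b : ℕ} (hS : ∀ i < a, ExactAt A (· ≤ ·) S i)
    (hT : ∀ j < b, ExactAt A (· ≤ ·) T j) {k : ℕ} (hk : k < a + b)
    {z : ListModule A P ⊗[A] ListModule A Q} (hz : z ∈ tensorChains A S T k)
    (hdz : tensorDel z = 0) :
    ∃ w ∈ tensorChains A S T (k + 1), tensorDel w = z := by
  obtain ⟨h, hmem, hh⟩ := exists_contraction hS
  obtain ⟨g, gmem, hg⟩ := exists_contraction hT
  -- `π` is a chain map homotopic to the identity that vanishes on chains of `S` with fewer than `a`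
  -- entries.
  let π : ListModule A P →ₗ[A] ListModule A P := LinearMap.id - del ∘ₗ h - h ∘ₗ del
  have πmem (i : ℕ) (u) (hu : u ∈ chains A (· ≤ ·) S i) : π u ∈ chains A (· ≤ ·) S i := by
    refine sub_mem (sub_mem hu (del_mem_chains (hmem _ _ hu))) ?_
    cases i with
    | zero => simp [del_eq_zero_of_mem_chains_zero hu]
    | succ i => exact hmem _ _ (del_mem_chains hu)
  have πdel (u) : del (π u) = π (del u) := by simp [π]
  let H : ListModule A P ⊗[A] ListModule A Q →ₗ[A] ListModule A P ⊗[A] ListModule A Q :=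
    TensorProduct.map h LinearMap.id + TensorProduct.map (π ∘ₗ signMap) g
  have Hmem : H z ∈ tensorChains A S T (k + 1) := by
    refine map_mem_of_tensorChains (fun i j l m hij hl hm => ?_) hz
    have hl := single_mem_chains (A := A) hl
    have hm := single_mem_chains (A := A) hm
    simp only [H, LinearMap.add_apply, TensorProduct.map_tmul, LinearMap.id_apply,
      LinearMap.comp_apply]
    refine add_mem (tmul_mem_tensorChains (by omega) (hmem _ _ hl) hm)
      (tmul_mem_tensorChains (i := i) (j := j + 1) (by omega) (πmem _ _ ?_) (gmem _ _ hm))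
    rw [signMap_eq hl]
    exact Submodule.smul_mem _ _ hl
  refine ⟨H z, Hmem, ?_⟩
  have key : (tensorDel ∘ₗ H + H ∘ₗ tensorDel) z = (LinearMap.id : _ →ₗ[A] _) z := by
    refine eq_of_tensorChains (fun i j l m hij hl hm => ?_) hz
    have hl := single_mem_chains (A := A) hl
    have hm := single_mem_chains (A := A) hm
    generalize Finsupp.single l (1 : A) = u at *
    generalize Finsupp.single m (1 : A) = v at *
    have e1 : signMap u = (-1 : A) ^ i • u := signMap_eq hl
    have e2 : signMap (h u) = -((-1 : A) ^ i • h u) := by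
      rw [signMap_eq (hmem _ _ hl), pow_succ]; simp
    have e3 : signMap (π u) = (-1 : A) ^ i • π u := signMap_eq (πmem _ _ hl)
    have e4 : (-1 : A) ^ i * (-1 : A) ^ i = 1 := by rw [← mul_pow]; simp
    have e5 : del (h u) ⊗ₜ[A] v + h (del u) ⊗ₜ[A] v + π u ⊗ₜ[A] (del (g v) + g (del v)) =
        u ⊗ₜ v := by
      have hπ : π u = u - del (h u) - h (del u) := rfl
      -- Since `i + j = k < a + b`, either `i < a`, where `π u = 0` and `h` alone contracts, or `j <
      -- b`, where `g` contracts the part `π u ⊗ v` missed by `h`.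
      rcases lt_or_ge i a with hi | hi
      · have h1 := hh i hi u hl
        have : π u = 0 := by rw [hπ]; nth_rewrite 1 [← h1]; abel
        rw [this, ← TensorProduct.add_tmul, h1, TensorProduct.zero_tmul, add_zero]
      · rw [hg j (by omega) v hm, ← TensorProduct.add_tmul, ← TensorProduct.add_tmul, hπ]
        congr 1
        abel
    simp only [H, LinearMap.add_apply, LinearMap.comp_apply, TensorProduct.map_tmul,
      LinearMap.id_apply, tensorDel_tmul, map_add, e1, e2, e3, map_smul, smul_smul, e4, one_smul,
      signMap_del, map_neg, πdel, TensorProduct.neg_tmul]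
    rw [← e5, TensorProduct.tmul_add]
    abel
  simpa [hdz] using key

end Preorder

/-! ### Splitting lists -/

section Split

open Classical in
/-- Split a list into the images under `φ` of the entries that satisfy `D` and the images under `ψ`
of the other ones. -/
def splitList (D : R → Prop) (φ : R → P) (ψ : R → Q) : List R → ListModule A P ⊗[A] ListModule A Q
  | [] => Finsupp.single [] (1 : A) ⊗ₜ Finsupp.single [] (1 : A)
  | x :: l => if D x then TensorProduct.map (consMap (φ x)) LinearMap.id (splitList D φ ψ l)
      else TensorProduct.map LinearMap.id (consMap (ψ x)) (splitList D φ ψ l)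

/-- The linear extension of `splitList`. -/
def split (D : R → Prop) (φ : R → P) (ψ : R → Q) :
    ListModule A R →ₗ[A] ListModule A P ⊗[A] ListModule A Q :=
  Finsupp.linearCombination A (splitList D φ ψ)

variable {D : R → Prop} {φ : R → P} {ψ : R → Q}

@[simp] theorem split_single (l : List R) :
    split D φ ψ (Finsupp.single l (1 : A)) = splitList D φ ψ l := by simp [split]

theorem split_consMap_of_pos {x : R} (hx : D x) (u : ListModule A R) :
    split D φ ψ (consMap x u) =
      TensorProduct.map (consMap (φ x)) LinearMap.id (split D φ ψ u) := by
  have : split D φ ψ ∘ₗ consMap (A := A) x =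
      TensorProduct.map (consMap (φ x)) LinearMap.id ∘ₗ split D φ ψ :=
    ListModule.hom_ext fun l => by simp [splitList, hx]
  exact LinearMap.congr_fun this u

theorem split_consMap_of_neg {x : R} (hx : ¬ D x) (u : ListModule A R) :
    split D φ ψ (consMap x u) =
      TensorProduct.map LinearMap.id (consMap (ψ x)) (split D φ ψ u) := by
  have : split D φ ψ ∘ₗ consMap (A := A) x =
      TensorProduct.map LinearMap.id (consMap (ψ x)) ∘ₗ split D φ ψ :=
    ListModule.hom_ext fun l => by simp [splitList, hx]
  exact LinearMap.congr_fun this u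

theorem splitList_of_neg {l : List R} (h : ∀ x ∈ l, ¬ D x) :
    splitList D φ ψ l = Finsupp.single [] (1 : A) ⊗ₜ Finsupp.single (l.map ψ) (1 : A) := by
  induction l with
  | nil => rfl
  | cons x l ih =>
    rw [splitList, if_neg (h x (by simp)), ih fun y hy => h y (by simp [hy])]
    simp

theorem tensorDel_map_left (p : P) (w : ListModule A P ⊗[A] ListModule A Q) :
    tensorDel (TensorProduct.map (consMap p) LinearMap.id w) =
      w - TensorProduct.map (consMap p) LinearMap.id (tensorDel w) := by
  have : (tensorDel : ListModule A P ⊗[A] ListModule A Q →ₗ[A] _) ∘ₗ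
      TensorProduct.map (consMap p) LinearMap.id +
        TensorProduct.map (consMap p) LinearMap.id ∘ₗ tensorDel = LinearMap.id :=
    TensorProduct.ext' fun u v => by
      simp only [LinearMap.comp_apply, LinearMap.add_apply, LinearMap.id_apply,
        TensorProduct.map_tmul, tensorDel_tmul, del_consMap, signMap_consMap, map_add,
        TensorProduct.sub_tmul, TensorProduct.neg_tmul]
      abel
  exact eq_sub_of_add_eq (LinearMap.congr_fun this w)

/-- The entries satisfying `D` form an initial segment, so splitting is cutting the list in two, and
the sign of a face in the second piece is the Koszul sign of the first. -/
theorem tensorDel_splitList {l : List R} (h : l.Pairwise fun x y => D y → D x) :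
    tensorDel (splitList D φ ψ l) = split (A := A) D φ ψ (listBoundary l) := by
  induction l with
  | nil => simp [splitList]
  | cons x l ih =>
    rw [List.pairwise_cons] at h
    rw [listBoundary_cons, map_sub, split_single]
    by_cases hx : D x
    · rw [splitList, if_pos hx, tensorDel_map_left, ih h.2, split_consMap_of_pos hx]
    · have hl : ∀ y ∈ l, ¬ D y := fun y hy hD => hx (h.1 y hy hD)
      have e := splitList_of_neg (A := A) (φ := φ) (ψ := ψ) hl
      rw [splitList, if_neg hx, split_consMap_of_neg hx, ← ih h.2, e]
      simp [listBoundary_cons, TensorProduct.tmul_sub]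

theorem splitList_mem [Preorder P] [Preorder Q] [Preorder R] {S : Set P} {T : Set Q} {X : Set R}
    (hφ : Monotone φ) (hψ : Monotone ψ) (hS : ∀ x ∈ X, D x → φ x ∈ S)
    (hT : ∀ x ∈ X, ¬ D x → ψ x ∈ T) {k : ℕ} {l : List R} (hl : IsChainList (· ≤ ·) X k l) :
    splitList D φ ψ l ∈ tensorChains A S T k := by
  induction l generalizing S T X k with
  | nil =>
    have : k = 0 := hl.1.symm
    subst this
    exact tmul_mem_tensorChains (i := 0) (j := 0) rfl (single_mem_chains isChainList_nil)
      (single_mem_chains isChainList_nil)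
  | cons x l ih =>
    obtain ⟨k, rfl⟩ : ∃ j, k = j + 1 := ⟨l.length, by simpa using hl.length_eq.symm⟩
    obtain ⟨hx, hl⟩ := isChainList_cons.1 hl
    by_cases hD : D x
    · rw [splitList, if_pos hD]
      refine map_mem_of_tensorChains (fun i j l m hij hl hm => ?_)
        (ih (S := S ∩ {p | φ x ≤ p}) (T := T) (fun y hy hD => ⟨hS y hy.1 hD, hφ hy.2⟩)
          (fun y hy hD => hT y hy.1 hD) hl)
      rw [TensorProduct.map_tmul]
      exact tmul_mem_tensorChains (by omega)
        (consMap_mem_chains (hS x hx hD) (single_mem_chains hl)) (single_mem_chains hm)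
    · rw [splitList, if_neg hD]
      refine map_mem_of_tensorChains (fun i j l m hij hl hm => ?_)
        (ih (S := S) (T := T ∩ {p | ψ x ≤ p}) (fun y hy hD => hS y hy.1 hD)
          (fun y hy hD => ⟨hT y hy.1 hD, hψ hy.2⟩) hl)
      rw [TensorProduct.map_tmul]
      exact tmul_mem_tensorChains (i := i) (j := j + 1) (by omega) (single_mem_chains hl)
        (consMap_mem_chains (hT x hx hD) (single_mem_chains hm))

end Split

/-! ### Ordinal sums -/

section OrdinalSum

/-- Concatenation of lists. -/
def appendMap : ListModule A P ⊗[A] ListModule A P →ₗ[A] ListModule A P :=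
  TensorProduct.lift (Finsupp.linearCombination A fun l =>
    Finsupp.linearCombination A fun m => Finsupp.single (l ++ m) (1 : A))

@[simp] theorem appendMap_single (l m : List P) :
    appendMap (Finsupp.single l (1 : A) ⊗ₜ Finsupp.single m (1 : A)) =
        Finsupp.single (l ++ m) (1 : A) := by
  simp [appendMap]

theorem appendMap_nil (v : ListModule A P) : appendMap (Finsupp.single [] (1 : A) ⊗ₜ v) = v := by
  have : appendMap ∘ₗ TensorProduct.mk A _ _ (Finsupp.single [] (1 : A)) =
      (LinearMap.id : ListModule A P →ₗ[A] _) := ListModule.hom_ext fun l => by simp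
  exact LinearMap.congr_fun this v

theorem appendMap_map_consMap (a : P) (w : ListModule A P ⊗[A] ListModule A P) :
    appendMap (TensorProduct.map (consMap a) LinearMap.id w) = consMap a (appendMap w) := by
  have : appendMap ∘ₗ TensorProduct.map (consMap (A := A) a) LinearMap.id =
      consMap a ∘ₗ appendMap :=
    tensor_hom_ext fun l m => by simp
  exact LinearMap.congr_fun this w

theorem del_appendMap (w : ListModule A P ⊗[A] ListModule A P) :
    del (appendMap w) = appendMap (tensorDel w) := by
  have : del ∘ₗ appendMap =
      appendMap ∘ₗ (tensorDel : ListModule A P ⊗[A] ListModule A P →ₗ[A] _) := by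
    refine tensor_hom_ext fun l m => ?_
    simp only [LinearMap.comp_apply]
    induction l with
    | nil => simp [appendMap_nil]
    | cons a l ih =>
      have : Finsupp.single (a :: l) (1 : A) ⊗ₜ[A] Finsupp.single m (1 : A) =
          TensorProduct.map (consMap a) LinearMap.id
            (Finsupp.single l (1 : A) ⊗ₜ Finsupp.single m (1 : A)) := by simp
      rw [this, tensorDel_map_left, appendMap_map_consMap, del_consMap, ih, map_sub,
        appendMap_map_consMap]
  exact LinearMap.congr_fun this w

theorem appendMap_splitList {D : P → Prop} {l : List P} (h : l.Pairwise fun x y => D y → D x) :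
    appendMap (splitList D id id l) = Finsupp.single l (1 : A) := by
  induction l with
  | nil => simp [splitList]
  | cons x l ih =>
    rw [List.pairwise_cons] at h
    by_cases hx : D x
    · rw [splitList, if_pos hx, appendMap_map_consMap, ih h.2]
      simp
    · rw [splitList_of_neg (List.forall_mem_cons.2 ⟨hx, fun y hy hD => hx (h.1 y hy hD)⟩)]
      simp

/-- A chain of the ordinal sum is a chain of `L` followed by one of `U`. Cutting and concatenating
identify its complex with the tensor product, so exactness ranges add. -/
theorem exactAt_union [Preorder P] {L U : Set P} (hLU : ∀ x ∈ L, ∀ y ∈ U, x < y) {a b : ℕ}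
    (hL : ∀ i < a, ExactAt A (· ≤ ·) L i) (hU : ∀ j < b, ExactAt A (· ≤ ·) U j) {k : ℕ}
    (hk : k < a + b) : ExactAt A (· ≤ ·) (L ∪ U) k := by
  intro z hz hdz
  let D : P → Prop := (· ∈ L)
  have hpair {k : ℕ} {l : List P} (hl : IsChainList (· ≤ ·) (L ∪ U) k l) :
      l.Pairwise fun x y => D y → D x := by
    refine (List.Pairwise.and_mem.1 hl.pairwise).imp ?_
    rintro x y ⟨hx, hy, hxy⟩ hyL
    exact (hl.mem x hx).resolve_right fun hxU => (hLU y hyL x hxU).not_ge hxy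
  have h1 : split D id id z ∈ tensorChains A L U k :=
    map_mem_of_chains (fun l hl => by
      rw [split_single]
      exact splitList_mem monotone_id monotone_id (fun _ _ h => h)
        (fun x hx h => hx.resolve_left h) hl) hz
  have h2 : tensorDel (split D id id z) = 0 := by
    have : (tensorDel ∘ₗ split D id id) z = (split D id id ∘ₗ del) z :=
      eq_of_chains (fun l hl => by simpa using tensorDel_splitList (hpair hl)) hz
    simpa [hdz] using this
  obtain ⟨w, hw, e⟩ := tensor_exact hL hU hk h1 h2
  refine ⟨appendMap w, map_mem_of_tensorChains (fun i j l m hij hl hm => ?_) hw, ?_⟩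
  · rw [appendMap_single]
    refine single_mem_chains ⟨by rw [List.length_append, hl.1, hm.1, hij], ?_, ?_⟩
    · exact List.pairwise_append.2 ⟨hl.2, hm.2, fun x hx y hy =>
        (hLU x (hl.3 x hx) y (hm.3 y hy)).le⟩
    · intro x hx
      exact (List.mem_append.1 hx).imp (hl.3 x) (hm.3 x)
  · rw [del_appendMap, e]
    exact eq_of_chains (f := appendMap ∘ₗ split D id id) (g := LinearMap.id)
      (fun l hl => by simpa using appendMap_splitList (hpair hl)) hz

end OrdinalSum

/-! ### Punctured products -/

section Product

variable (y₁ : P) (y₂ : Q)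

/-- The Eilenberg-Zilber shuffle of two lists, where exhausted lists are continued by `y₁` and
`y₂`. -/
def shuffleList : List P → List Q → ListModule A (P × Q)
  | [], [] => Finsupp.single [] (1 : A)
  | p :: l, [] => consMap (p, y₂) (shuffleList l [])
  | [], q :: m => consMap (y₁, q) (shuffleList [] m)
  -- A lattice path leaves the corner `(p, q)` by dropping `p` or by dropping `q`; dropping `q`
  -- first moves it past all of `p :: l`, which gives the total sign `-(-1) ^ l.length`. Paths head
  -- for `(y₁, y₂)`, which is omitted.
  | p :: l, q :: m => consMap (p, q)
      (shuffleList l (q :: m) - (-1 : A) ^ l.length • shuffleList (p :: l) m)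
termination_by l m => l.length + m.length

/-- The bilinear extension of `shuffleList`. -/
def shuffle : ListModule A P ⊗[A] ListModule A Q →ₗ[A] ListModule A (P × Q) :=
  TensorProduct.lift (Finsupp.linearCombination A fun l =>
    Finsupp.linearCombination A fun m => shuffleList y₁ y₂ l m)

@[simp] theorem shuffle_single (l : List P) (m : List Q) :
    shuffle y₁ y₂ (Finsupp.single l (1 : A) ⊗ₜ Finsupp.single m (1 : A)) =
      shuffleList y₁ y₂ l m := by
  simp [shuffle]

theorem shuffle_consMap_nil (p : P) (u : ListModule A P) :
    shuffle y₁ y₂ (consMap p u ⊗ₜ Finsupp.single [] (1 : A)) =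
      consMap (p, y₂) (shuffle y₁ y₂ (u ⊗ₜ Finsupp.single [] (1 : A))) := by
  have : shuffle y₁ y₂ ∘ₗ (TensorProduct.mk A _ _).flip (Finsupp.single ([] : List Q) (1 : A)) ∘ₗ
      consMap p =
      consMap (p, y₂) ∘ₗ shuffle y₁ y₂ ∘ₗ (TensorProduct.mk A _ _).flip
          (Finsupp.single [] (1 : A)) :=
    ListModule.hom_ext fun l => by simp [shuffleList]
  exact LinearMap.congr_fun this u

theorem shuffle_nil_consMap (q : Q) (v : ListModule A Q) :
    shuffle y₁ y₂ (Finsupp.single [] (1 : A) ⊗ₜ consMap q v) =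
      consMap (y₁, q) (shuffle y₁ y₂ (Finsupp.single [] (1 : A) ⊗ₜ v)) := by
  have : shuffle y₁ y₂ ∘ₗ (TensorProduct.mk A _ _ (Finsupp.single [] (1 : A))) ∘ₗ consMap q =
      consMap (y₁, q) ∘ₗ shuffle y₁ y₂ ∘ₗ (TensorProduct.mk A _ _ (Finsupp.single [] (1 : A))) :=
    ListModule.hom_ext fun l => by simp [shuffleList]
  exact LinearMap.congr_fun this v

theorem shuffle_consMap_consMap (p : P) (q : Q) (u : ListModule A P) (v : ListModule A Q) :
    shuffle y₁ y₂ (consMap p u ⊗ₜ consMap q v) = consMap (p, q)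
      (shuffle y₁ y₂ (u ⊗ₜ consMap q v) - shuffle y₁ y₂ (consMap p (signMap u) ⊗ₜ v)) := by
  have : shuffle (A := A) y₁ y₂ ∘ₗ TensorProduct.map (consMap p) (consMap q) = consMap (p, q) ∘ₗ
      (shuffle y₁ y₂ ∘ₗ TensorProduct.map LinearMap.id (consMap q) -
        shuffle y₁ y₂ ∘ₗ TensorProduct.map (consMap p ∘ₗ signMap) LinearMap.id) :=
    tensor_hom_ext fun l m => by
      simp only [LinearMap.comp_apply, LinearMap.sub_apply, TensorProduct.map_tmul,
        LinearMap.id_apply, consMap_single, shuffle_single, signMap_single, map_smul,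
        ← TensorProduct.smul_tmul', shuffleList]
  exact LinearMap.congr_fun this (u ⊗ₜ v)

theorem del_shuffle (w : ListModule A P ⊗[A] ListModule A Q) :
    del (shuffle y₁ y₂ w) = shuffle y₁ y₂ (tensorDel w) := by
  suffices del ∘ₗ shuffle y₁ y₂ = shuffle y₁ y₂ ∘ₗ tensorDel from LinearMap.congr_fun this w
  refine tensor_hom_ext fun l => ?_
  have hs (x : P) (l : List P) :
    Finsupp.single (x :: l) (1 : A) = consMap x (Finsupp.single l (1 : A)) := by simp
  have hs' (x : Q) (l : List Q) :
    Finsupp.single (x :: l) (1 : A) = consMap x (Finsupp.single l (1 : A)) := by simp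
  simp only [LinearMap.comp_apply]
  induction l with
  | nil =>
    intro m
    induction m with
    | nil => simp [shuffleList]
    | cons q m ih =>
      rw [hs', shuffle_nil_consMap, del_consMap, ih]
      simp [shuffle_nil_consMap, TensorProduct.tmul_sub, listBoundary_cons]
  | cons p l ihl =>
    intro m
    induction m with
    | nil =>
      rw [hs, shuffle_consMap_nil, del_consMap, ihl]
      simp [shuffle_consMap_nil, TensorProduct.sub_tmul, listBoundary_cons]
    | cons q m ihm =>
      have h1 := ihl (q :: m)
      have h2 : del (shuffle y₁ y₂ (consMap p (signMap (Finsupp.single l (1 : A))) ⊗ₜ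
          Finsupp.single m (1 : A))) = shuffle y₁ y₂ (tensorDel
            (consMap p (signMap (Finsupp.single l (1 : A))) ⊗ₜ Finsupp.single m (1 : A))) := by
        rw [signMap_single, map_smul, ← TensorProduct.smul_tmul', map_smul, map_smul, map_smul,
          map_smul, consMap_single, ihm]
      rw [hs'] at h1
      rw [hs, hs', shuffle_consMap_consMap, del_consMap, map_sub, h1, h2]
      generalize Finsupp.single l (1 : A) = u
      generalize Finsupp.single m (1 : A) = v
      have hneg (u : ListModule A P) (v : ListModule A Q) :
          shuffle y₁ y₂ ((-u) ⊗ₜ v) = - shuffle y₁ y₂ (u ⊗ₜ v) :=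
        LinearMap.map_neg₂ ((TensorProduct.mk A _ _).compr₂ (shuffle y₁ y₂)) u v
      simp only [tensorDel_tmul, map_add, del_consMap, signMap_consMap, TensorProduct.sub_tmul,
        TensorProduct.tmul_sub, map_sub, hneg, map_neg, shuffle_consMap_consMap,
        signMap_del]
      abel

/-- `S`, `T` and `Y` shrink during the induction to the parts above the vertex just prepended. -/
theorem shuffleList_mem [Preorder P] [Preorder Q] {y₁ : P} {y₂ : Q} {S : Set P} {T : Set Q}
    (hS : ∀ p ∈ S, p ≤ y₁) (hT : ∀ q ∈ T, q ≤ y₂) {Y : Set (P × Q)}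
    (h : ∀ p ∈ S, ∀ q ∈ T, (p, q) ∈ Y) (hl : ∀ p ∈ S, (p, y₂) ∈ Y) (hr : ∀ q ∈ T, (y₁, q) ∈ Y)
    {i j : ℕ} {l : List P} {m : List Q} (cl : IsChainList (· ≤ ·) S i l)
    (cm : IsChainList (· ≤ ·) T j m) : shuffleList y₁ y₂ l m ∈ chains A (· ≤ ·) Y (i + j) := by
  induction l, m using shuffleList.induct generalizing S T Y i j with
  | case1 =>
    rw [← cl.1, ← cm.1, shuffleList]
    exact single_mem_chains isChainList_nil
  | case2 p l ih =>
    obtain ⟨i, rfl⟩ : ∃ i', i = i' + 1 := ⟨l.length, by simpa using cl.length_eq.symm⟩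
    obtain ⟨hp, cl⟩ := isChainList_cons.1 cl
    rw [shuffleList, add_right_comm]
    -- `T` is replaced by `∅`: the second list is exhausted, and points `(y₁, q)` with `q` in `T`
    -- need not lie above `(p, y₂)`.
    refine consMap_mem_chains (hl p hp)
        (ih (T := ∅) (Y := Y ∩ {x | (p, y₂) ≤ x}) (fun _ h => hS _ h.1) (by simp) (by simp)
      (fun p' hp' => ⟨hl _ hp'.1, hp'.2, le_rfl⟩) (by simp) cl ⟨cm.1, cm.2, by simp⟩)
  | case3 q m ih =>
    obtain ⟨j, rfl⟩ : ∃ j', j = j' + 1 := ⟨m.length, by simpa using cm.length_eq.symm⟩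
    obtain ⟨hq, cm⟩ := isChainList_cons.1 cm
    rw [shuffleList, ← add_assoc]
    refine consMap_mem_chains (hr q hq)
        (ih (S := ∅) (Y := Y ∩ {x | (y₁, q) ≤ x}) (by simp) (fun _ h => hT _ h.1) (by simp)
      (by simp) (fun q' hq' => ⟨hr _ hq'.1, le_rfl, hq'.2⟩) ⟨cl.1, cl.2, by simp⟩ cm)
  | case4 p l q m ih1 ih2 =>
    obtain ⟨i, rfl⟩ : ∃ i', i = i' + 1 := ⟨l.length, by simpa using cl.length_eq.symm⟩
    obtain ⟨j, rfl⟩ : ∃ j', j = j' + 1 := ⟨m.length, by simpa using cm.length_eq.symm⟩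
    obtain ⟨hp, cl'⟩ := isChainList_cons.1 cl
    obtain ⟨hq, cm'⟩ := isChainList_cons.1 cm
    have clp : IsChainList (· ≤ ·) (S ∩ {x | p ≤ x}) (i + 1) (p :: l) :=
      isChainList_cons.2 ⟨⟨hp, le_rfl⟩, cl'.mono fun x hx => ⟨hx, hx.2⟩⟩
    have cmq : IsChainList (· ≤ ·) (T ∩ {x | q ≤ x}) (j + 1) (q :: m) :=
      isChainList_cons.2 ⟨⟨hq, le_rfl⟩, cm'.mono fun x hx => ⟨hx, hx.2⟩⟩
    rw [shuffleList, ← add_assoc]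
    have A1 : ∀ p' ∈ S ∩ {x | p ≤ x}, p' ≤ y₁ := fun _ h => hS _ h.1
    have A2 : ∀ q' ∈ T ∩ {x | q ≤ x}, q' ≤ y₂ := fun _ h => hT _ h.1
    have A3 : ∀ p' ∈ S ∩ {x | p ≤ x}, ∀ q' ∈ T ∩ {x | q ≤ x},
      (p', q') ∈ Y ∩ {x | (p, q) ≤ x} := fun p' hp' q' hq' => ⟨h _ hp'.1 _ hq'.1, hp'.2, hq'.2⟩
    have A4 : ∀ p' ∈ S ∩ {x | p ≤ x}, (p', y₂) ∈ Y ∩ {x | (p, q) ≤ x} :=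
      fun p' hp' => ⟨hl _ hp'.1, hp'.2, hT _ hq⟩
    have A5 : ∀ q' ∈ T ∩ {x | q ≤ x}, (y₁, q') ∈ Y ∩ {x | (p, q) ≤ x} :=
      fun q' hq' => ⟨hr _ hq'.1, hS _ hp, hq'.2⟩
    refine consMap_mem_chains (h p hp q hq) (sub_mem ?_ (Submodule.smul_mem _ _ ?_))
    · rw [show i + 1 + j = i + (j + 1) by omega]
      exact ih1 A1 A2 A3 A4 A5 cl' cmq
    · exact ih2 A1 A2 A3 A4 A5 clp cm'

/-- The product of `S ∪ {y₁}` and `T ∪ {y₂}` without the point `(y₁, y₂)`. -/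
def puncturedProduct (S : Set P) (T : Set Q) : Set (P × Q) :=
  {x | (x.1 ∈ S ∨ x.1 = y₁) ∧ (x.2 ∈ T ∨ x.2 = y₂) ∧ x ≠ (y₁, y₂)}

variable {y₁ y₂}

/-- The punctured product has the homotopy type of the join of `S` and `T`. It suffices that its
complex is a homotopy retract of the tensor product: splitting followed by shuffling is homotopic to
the identity. -/
theorem exactAt_puncturedProduct [PartialOrder P] [PartialOrder Q] {S : Set P} {T : Set Q}
    (hS : ∀ p ∈ S, p < y₁) (hT : ∀ q ∈ T, q < y₂) {a b : ℕ}
    (eS : ∀ i < a, ExactAt A (· ≤ ·) S i) (eT : ∀ j < b, ExactAt A (· ≤ ·) T j) {k : ℕ}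
    (hk : k < a + b) : ExactAt A (· ≤ ·) (puncturedProduct y₁ y₂ S T) k := by
  intro z hz hdz
  set X := puncturedProduct y₁ y₂ S T
  -- As `y₁` is the greatest first coordinate, entries with another first coordinate come first and
  -- project to `S`; the remaining ones have second coordinate in `T`.
  let D : P × Q → Prop := fun x => x.1 ≠ y₁
  let G := split (A := A) D Prod.fst Prod.snd
  have h1 : ∀ x ∈ X, D x → x.1 ∈ S := fun x hx hD => hx.1.resolve_right hD
  have h2 : ∀ x ∈ X, ¬ D x → x.2 ∈ T := fun x hx hD =>
    hx.2.1.resolve_right fun e => hx.2.2 (Prod.ext (not_not.1 hD) e)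
  have hX : ∀ x ∈ X, x.1 ≤ y₁ ∧ x.2 ≤ y₂ := fun x hx =>
    ⟨hx.1.elim (fun h => (hS _ h).le) le_of_eq, hx.2.1.elim (fun h => (hT _ h).le) le_of_eq⟩
  have hpair {k : ℕ} {l : List (P × Q)} (hl : IsChainList (· ≤ ·) X k l) :
      l.Pairwise fun x y => D y → D x := by
    refine (List.Pairwise.and_mem.1 hl.pairwise).imp ?_
    rintro x y ⟨hx, hy, hxy⟩ hyD hxD
    exact hyD (le_antisymm (hX y (hl.mem y hy)).1 (hxD ▸ hxy.1))
  have Gmem (k : ℕ) (u) (hu : u ∈ chains A (· ≤ ·) X k) : G u ∈ tensorChains A S T k :=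
    map_mem_of_chains (fun l hl => by
      rw [split_single]
      exact splitList_mem monotone_fst monotone_snd h1 h2 hl) hu
  have Gdel (k : ℕ) (u) (hu : u ∈ chains A (· ≤ ·) X k) : tensorDel (G u) = G (del u) :=
    eq_of_chains (f := tensorDel ∘ₗ G) (g := G ∘ₗ del)
      (fun l hl => by simpa [G] using tensorDel_splitList (hpair hl)) hu
  have m1 : ∀ p ∈ S, ∀ q ∈ T, (p, q) ∈ X := fun p hp q hq =>
    ⟨Or.inl hp, Or.inl hq, fun e => (hS p hp).ne (congrArg Prod.fst e)⟩
  have m2 : ∀ p ∈ S, (p, y₂) ∈ X := fun p hp =>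
    ⟨Or.inl hp, Or.inr rfl, fun e => (hS p hp).ne (congrArg Prod.fst e)⟩
  have m3 : ∀ q ∈ T, (y₁, q) ∈ X := fun q hq =>
    ⟨Or.inr rfl, Or.inl hq, fun e => (hT q hq).ne (congrArg Prod.snd e)⟩
  obtain ⟨w, hw, e⟩ := tensor_exact eS eT hk (Gmem k z hz) (by rw [Gdel k z hz, hdz, map_zero])
  -- Both maps preserve the part above any `x`, so `z` and `shuffle (G z)` differ by a boundary, and
  -- `shuffle (G z)` bounds `shuffle w`.
  obtain ⟨w', hw', e'⟩ := sub_mem_boundaries_of_carried (shuffle y₁ y₂ ∘ₗ G)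
    (by simp [G, splitList, shuffleList])
    (fun x hx k u hu => by
      have hG : G u ∈ tensorChains A (S ∩ {p | x.1 ≤ p}) (T ∩ {q | x.2 ≤ q}) k :=
        map_mem_of_chains (fun l hl => by
          rw [split_single]
          exact splitList_mem (S := S ∩ {p | x.1 ≤ p}) (T := T ∩ {q | x.2 ≤ q})
            monotone_fst monotone_snd (X := X ∩ {y | x ≤ y}) (fun y hy hD => ⟨h1 y hy.1 hD, hy.2.1⟩)
            (fun y hy hD => ⟨h2 y hy.1 hD, hy.2.2⟩) hl) hu
      rw [LinearMap.comp_apply]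
      refine map_mem_of_tensorChains (fun i j l m hij hl hm => ?_) hG
      rw [shuffle_single, ← hij]
      exact shuffleList_mem (S := S ∩ {p | x.1 ≤ p}) (T := T ∩ {q | x.2 ≤ q})
        (Y := X ∩ {y | x ≤ y}) (fun _ h => (hS _ h.1).le) (fun _ h => (hT _ h.1).le)
        (fun p hp q hq => ⟨m1 p hp.1 q hq.1, hp.2, hq.2⟩)
        (fun p hp => ⟨m2 p hp.1, hp.2, (hX x hx).2⟩)
        (fun q hq => ⟨m3 q hq.1, (hX x hx).1, hq.2⟩) hl hm)
    (fun k u hu => by simp [del_shuffle, Gdel k u hu]) hz hdz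
  refine ⟨shuffle y₁ y₂ w + w', add_mem (map_mem_of_tensorChains (fun i j l m hij hl hm => ?_) hw)
    hw', by rw [map_add, del_shuffle, e, e']; simp⟩
  rw [shuffle_single, ← show i + j = k + 1 from hij]
  exact shuffleList_mem (fun _ h => (hS _ h).le) (fun _ h => (hT _ h).le) m1 m2 m3 hl hm

end Product

end Tensor

/-! ### Mayer-Vietoris -/

/-- Every chain lies in one of the two pieces, so a cycle splits as `z₁ + z₂`; the common boundary
`del z₁ = -del z₂` lives in the intersection and is filled there. For `k = 0` the condition on `U₀`
is vacuous. -/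
theorem exactAt_of_cover {A : Type*} [CommRing A] {P : Type*} {r : P → P → Prop}
    {U U₁ U₂ U₀ : Set P} (h₁ : U₁ ⊆ U)
    (h₂ : U₂ ⊆ U) (h₀ : U₀ = U₁ ∩ U₂)
    (hU : ∀ l : List P, l.Pairwise r → (∀ x ∈ l, x ∈ U) → (∀ x ∈ l, x ∈ U₁) ∨ ∀ x ∈ l, x ∈ U₂)
    {k : ℕ} (e₁ : ExactAt A r U₁ k) (e₂ : ExactAt A r U₂ k)
    (e₀ : ∀ j, j + 1 = k → ExactAt A r U₀ j) :
    ExactAt A r U k := by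
  classical
  subst h₀
  intro z hz hdz
  have hsplit : z ∈ chains A r U₁ k ⊔ chains A r U₂ k := by
    refine map_mem_of_chains (f := LinearMap.id) (fun l hl => ?_) hz
    rcases hU l hl.pairwise hl.mem with h | h
    · exact Submodule.mem_sup_left (single_mem_chains ⟨hl.1, hl.2, h⟩)
    · exact Submodule.mem_sup_right (single_mem_chains ⟨hl.1, hl.2, h⟩)
  obtain ⟨z₁, hz₁, z₂, hz₂, rfl⟩ := Submodule.mem_sup.1 hsplit
  obtain ⟨v, hv₁, hv₂, hv⟩ : ∃ v, v ∈ chains A r U₁ k ∧ v ∈ chains A r U₂ k ∧ del v = del z₁ := by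
    cases k with
    | zero => exact ⟨0, zero_mem _, zero_mem _, by simp [del_eq_zero_of_mem_chains_zero hz₁]⟩
    | succ k =>
      have hneg : del z₁ = - del z₂ := eq_neg_of_add_eq_zero_left (by rw [← map_add, hdz])
      have hmem : del z₁ ∈ chains A r (U₁ ∩ U₂) k := by
        have a₁ := del_mem_chains hz₁
        have a₂ : del z₁ ∈ chains A r U₂ k := hneg ▸ neg_mem (del_mem_chains hz₂)
        -- Described by supports, an element of both spans is visibly a combination of the common
        -- lists.
        have hc (S : Set P) : chains A r S k = Finsupp.supported A A {l | IsChainList r S k l} := by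
          rw [Finsupp.supported_eq_span_single, chains]
          congr 1
          ext u
          constructor
          · rintro ⟨l, hl, rfl⟩; exact ⟨l, hl, rfl⟩
          · rintro ⟨l, hl, rfl⟩; exact ⟨l, hl, rfl⟩
        rw [hc, Finsupp.mem_supported] at a₁ a₂ ⊢
        exact fun l hl => ⟨(a₁ hl).1, (a₁ hl).2, fun x hx => ⟨(a₁ hl).3 x hx, (a₂ hl).3 x hx⟩⟩
      obtain ⟨v, hv, e⟩ := e₀ k rfl _ hmem (del_del _)
      exact ⟨v, chains_mono Set.inter_subset_left hv, chains_mono Set.inter_subset_right hv, e⟩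
  obtain ⟨w₁, hw₁, d₁⟩ := e₁ (z₁ - v) (sub_mem hz₁ hv₁) (by rw [map_sub, hv, sub_self])
  obtain ⟨w₂, hw₂, d₂⟩ := e₂ (z₂ + v) (add_mem hz₂ hv₂) (by
    rw [map_add, hv, add_comm, ← map_add, hdz])
  exact ⟨w₁ + w₂, add_mem (chains_mono h₁ hw₁) (chains_mono h₂ hw₂), by
    rw [map_add, d₁, d₂]; abel⟩

/-! ### Comparison of lists with embeddings of `Fin k` -/

section Comparison

open CategoryTheory

variable {A : Type v} [CommRing A]

section

variable {P : Type u} [PartialOrder P]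

theorem augmentedComplex_d (k : ℕ) :
    (augmentedComplex A P).d (k + 1) k = ModuleCat.ofHom (boundary A P k) :=
  ChainComplex.of_d (fun k => ModuleCat.of A (SimplicialChains A P k))
    (fun k => ModuleCat.ofHom (boundary A P k)) k

theorem isZero_reducedHomology_zero_iff : Limits.IsZero (reducedHomology A P 0) ↔
    ∀ z, ∃ w, boundary A P 0 w = z := by
  rw [reducedHomology, ← HomologicalComplex.exactAt_iff_isZero_homology,
    HomologicalComplex.exactAt_iff' _ 1 0 0 (by simp) (by simp), ShortComplex.moduleCat_exact_iff]
  have h0 : (augmentedComplex A P).d 0 0 = 0 := HomologicalComplex.shape _ _ _ (by simp)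
  have h1 := augmentedComplex_d (A := A) (P := P) 0
  simp only [HomologicalComplex.shortComplexFunctor'_obj_f,
    HomologicalComplex.shortComplexFunctor'_obj_g, h0, h1]
  exact ⟨fun h z => h z rfl, fun h z _ => h z⟩

theorem isZero_reducedHomology_succ_iff (k : ℕ) :
    Limits.IsZero (reducedHomology A P (k + 1)) ↔
      ∀ z, boundary A P k z = 0 → ∃ w, boundary A P (k + 1) w = z := by
  rw [reducedHomology, ← HomologicalComplex.exactAt_iff_isZero_homology,
    HomologicalComplex.exactAt_iff' _ (k + 2) (k + 1) k (by simp) (by simp),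
    ShortComplex.moduleCat_exact_iff]
  simp only [HomologicalComplex.shortComplexFunctor'_obj_f,
    HomologicalComplex.shortComplexFunctor'_obj_g, augmentedComplex_d]
  exact ⟨fun h z => h z, fun h z => h z⟩

end

variable {P : Type u} [PartialOrder P] (S : Set P)

/-- The entries of a chain in `S`, as a list in `P`. -/
def chainToList {k : ℕ} (s : Fin k ↪o S) : List P := List.ofFn fun i => (s i : P)

theorem isChainList_chainToList {k : ℕ} (s : Fin k ↪o S) :
    IsChainList (· < ·) S k (chainToList S s) := by
  refine ⟨by simp [chainToList], ?_, ?_⟩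
  · rw [chainToList, List.pairwise_ofFn]
    exact fun i j hij => s.strictMono hij
  · intro x hx
    obtain ⟨i, rfl⟩ := List.mem_ofFn.1 hx
    exact (s i).2

theorem exists_chainToList_eq {k : ℕ} {l : List P} (h : IsChainList (· < ·) S k l) :
    ∃ s : Fin k ↪o S, chainToList S s = l := by
  obtain ⟨rfl, hp, hm⟩ := h
  have hmono : StrictMono fun i : Fin l.length => (⟨l.get i, hm _ (l.get_mem i)⟩ : S) :=
    fun i j hij => List.pairwise_iff_get.1 hp i j hij
  exact ⟨OrderEmbedding.ofStrictMono _ hmono, List.ofFn_get l⟩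

theorem chainToList_injective (k : ℕ) :
    Function.Injective (chainToList S : (Fin k ↪o S) → List P) := by
  intro s t h
  ext i
  exact congrFun (List.ofFn_injective h) i

theorem chainToList_succ {k : ℕ} (s : Fin (k + 1) ↪o S) :
    chainToList S s = (s 0 : P) :: chainToList S (face s 0) := by
  rw [chainToList, List.ofFn_succ]
  rfl

variable (A) in
/-- The simplicial chains of `S` as combinations of lists. -/
def chainsToLists (k : ℕ) : SimplicialChains A S k →ₗ[A] ListModule A P :=
  Finsupp.lmapDomain A A (chainToList S)

@[simp] theorem chainsToLists_single {k : ℕ} (s : Fin k ↪o S) :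
    chainsToLists A S k (Finsupp.single s 1) = Finsupp.single (chainToList S s) 1 := by
  simp [chainsToLists]

theorem chainsToLists_injective (k : ℕ) : Function.Injective (chainsToLists A S k) :=
  Finsupp.mapDomain_injective (chainToList_injective S k)

theorem chainsToLists_mem {k : ℕ} (z : SimplicialChains A S k) :
    chainsToLists A S k z ∈ chains A (· < ·) S k := by
  induction z using Finsupp.induction_linear with
  | zero => simp
  | add f g hf hg => rw [map_add]; exact add_mem hf hg
  | single s a =>
    rw [← mul_one a, ← smul_eq_mul, ← Finsupp.smul_single, map_smul, chainsToLists_single]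
    exact Submodule.smul_mem _ _ (single_mem_chains (isChainList_chainToList S s))

theorem exists_chainsToLists_eq {k : ℕ} {u : ListModule A P} (hu : u ∈ chains A (· < ·) S k) :
    ∃ z, chainsToLists A S k z = u :=
  map_mem_of_chains (f := LinearMap.id) (B := LinearMap.range (chainsToLists A S k))
    (fun l hl => by
      obtain ⟨s, rfl⟩ := exists_chainToList_eq S hl
      exact ⟨Finsupp.single s 1, by simp⟩) hu

theorem listBoundary_chainToList {k : ℕ} (s : Fin (k + 1) ↪o S) :
    (listBoundary (chainToList S s) : ListModule A P) =
      ∑ j : Fin (k + 1), (-1 : A) ^ (j : ℕ) • Finsupp.single (chainToList S (face s j)) 1 := by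
  induction k with
  | zero => rw [chainToList_succ, listBoundary_cons]; simp [chainToList]
  | succ k ih =>
    have hf (j : Fin (k + 1)) : chainToList S (face s j.succ) =
        (s 0 : P) :: chainToList S (face (face s 0) j) := by
      rw [chainToList_succ, ← face_face _ s 0 j]
      rfl
    rw [chainToList_succ, listBoundary_cons, ih]
    conv_rhs => rw [Fin.sum_univ_succ]
    simp only [hf, Fin.val_succ, pow_succ, map_sum, map_smul, consMap_single, Fin.val_zero,
        pow_zero,
      one_smul, mul_neg, mul_one, neg_smul, Finset.sum_neg_distrib, sub_eq_add_neg]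

theorem del_chainsToLists (k : ℕ) (z : SimplicialChains A S (k + 1)) :
    del (chainsToLists A S (k + 1) z) = chainsToLists A S k (boundary A S k z) := by
  have : del ∘ₗ chainsToLists A S (k + 1) = chainsToLists A S k ∘ₗ boundary A S k :=
    Finsupp.lhom_ext' fun s => LinearMap.ext_ring (by
      simp only [LinearMap.comp_apply, Finsupp.lsingle_apply, chainsToLists_single, del_single,
        boundary_single, map_sum, map_smul, listBoundary_chainToList])
  exact LinearMap.congr_fun this z

/-- The bridge between the official homology, built on strict chains, and `ExactAt` for weak chains.
-/
theorem isZero_reducedHomology_iff (k : ℕ) :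
    Limits.IsZero (reducedHomology A S k) ↔ ExactAt A (· ≤ ·) S k := by
  rw [← exactAt_lt_iff]
  cases k with
  | zero =>
    rw [isZero_reducedHomology_zero_iff]
    constructor
    · intro h z hz _
      obtain ⟨z, rfl⟩ := exists_chainsToLists_eq S hz
      obtain ⟨w, rfl⟩ := h z
      exact ⟨_, chainsToLists_mem S w, del_chainsToLists S 0 w⟩
    · intro h z
      obtain ⟨w, hw, e⟩ := h _ (chainsToLists_mem S z)
        (del_eq_zero_of_mem_chains_zero (chainsToLists_mem S z))
      obtain ⟨w, rfl⟩ := exists_chainsToLists_eq S hw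
      exact ⟨w, chainsToLists_injective S 0 (by rw [← del_chainsToLists, e])⟩
  | succ k =>
    rw [isZero_reducedHomology_succ_iff]
    constructor
    · intro h z hz hdz
      obtain ⟨z, rfl⟩ := exists_chainsToLists_eq S hz
      obtain ⟨w, rfl⟩ := h z (chainsToLists_injective S k (by
        rw [← del_chainsToLists, hdz, map_zero]))
      exact ⟨_, chainsToLists_mem S w, del_chainsToLists S _ w⟩
    · intro h z hz
      obtain ⟨w, hw, e⟩ := h _ (chainsToLists_mem S z) (by rw [del_chainsToLists, hz, map_zero])
      obtain ⟨w, rfl⟩ := exists_chainsToLists_eq S hw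
      exact ⟨w, chainsToLists_injective S _ (by rw [← del_chainsToLists, e])⟩

end Comparison

/-! ### Spherical sets -/

theorem exactAt_of_no_chains {A : Type*} [CommRing A] {P : Type*} {r : P → P → Prop} {S : Set P}
    {k : ℕ} (h : ∀ l, ¬ IsChainList r S k l) :
    ExactAt A r S k := by
  intro z hz _
  have : z = 0 := eq_of_chains (f := LinearMap.id) (g := 0) (fun l hl => (h l hl).elim) hz
  exact ⟨0, zero_mem _, by simp [this]⟩

section Spherical

variable (A : Type v) [CommRing A] {P Q : Type u} [PartialOrder P] [PartialOrder Q]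

/-- `r` is strictly increasing on `S`, with values less than `n`. -/
def IsRank (S : Set P) (n : ℕ) (r : P → ℕ) : Prop :=
  (∀ x ∈ S, r x < n) ∧ ∀ x ∈ S, ∀ y ∈ S, x < y → r x < r y

/-- The chains in `S` have at most `n` elements, as witnessed by a rank function, and the reduced
homology of `S` vanishes in degrees less than `n - 1`. -/
def IsSpherical (S : Set P) : Prop :=
  ∃ n, (∃ r, IsRank S n r) ∧ ∀ k < n, ExactAt A (· ≤ ·) S k

variable {A} {S : Set P}

theorem exactAt_of_isLeast {m : P} (hm : IsLeast S m) (k : ℕ) : ExactAt A (· ≤ ·) S k :=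
  fun z hz hdz => ⟨consMap m z, consMap_mem_chains hm.1 (chains_mono (T := S ∩ {x | m ≤ x})
    (fun _ hx => ⟨hx, hm.2 hx⟩) hz), by rw [del_consMap, hdz]; simp⟩

/-- `S` is the ordinal sum of `S \ {t}` and a point. The point is exact in every degree, so nothing
is asked of the lower part. -/
theorem exactAt_of_isGreatest {t : P} (ht : IsGreatest S t) (k : ℕ) : ExactAt A (· ≤ ·) S k := by
  have : S = (S \ {t}) ∪ {t} := by
    rw [Set.sdiff_union_self, Set.union_eq_left.2 (Set.singleton_subset_iff.2 ht.1)]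
  rw [this]
  refine exactAt_union (a := 0) (b := k + 1) ?_ (by simp)
    (fun j _ => exactAt_of_isLeast isLeast_singleton j) (by omega)
  rintro x ⟨hx, hxt⟩ y rfl
  exact lt_of_le_of_ne (ht.2 hx) hxt

theorem isSpherical_empty : IsSpherical A (∅ : Set P) :=
  ⟨0, ⟨fun _ => 0, by simp, by simp⟩, by simp⟩

theorem IsSpherical.union {L U : Set P} (hL : IsSpherical A L) (hU : IsSpherical A U)
    (hLU : ∀ x ∈ L, ∀ y ∈ U, x < y) : IsSpherical A (L ∪ U) := by
  classical
  obtain ⟨n, ⟨r, hr⟩, hn⟩ := hL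
  obtain ⟨m, ⟨s, hs⟩, hm⟩ := hU
  refine ⟨n + m, ⟨fun x => if x ∈ L then r x else n + s x, ?_, ?_⟩, fun k hk =>
    exactAt_union hLU hn hm hk⟩
  · intro x hx
    by_cases hxL : x ∈ L
    · have := hr.1 x hxL
      simp only [hxL, if_true]
      omega
    · have := hs.1 x (hx.resolve_left hxL)
      simp only [hxL, if_false]
      omega
  · intro x hx y hy hxy
    by_cases hxL : x ∈ L <;> by_cases hyL : y ∈ L <;> simp only [hxL, hyL, if_true, if_false]
    · exact hr.2 x hxL y hyL hxy
    · have := hr.1 x hxL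
      omega
    · exact absurd hxy (hLU y hyL x (hx.resolve_left hxL)).not_gt
    · have := hs.2 x (hx.resolve_left hxL) y (hy.resolve_left hyL) hxy
      omega

/-- Extending a rank function by a new top element. -/
theorem IsRank.exists_insert_top {y : P} {n : ℕ} {r : P → ℕ} (hS : ∀ p ∈ S, p < y)
    (hr : IsRank S n r) :
    ∃ r' : P → ℕ, r' y = n ∧ (∀ x ∈ S, r' x < n) ∧
      (∀ a b, (a ∈ S ∨ a = y) → (b ∈ S ∨ b = y) → a < b → r' a < r' b) := by
  classical
  have e (x) (hx : x ∈ S) : (if x = y then n else r x) = r x := if_neg (hS x hx).ne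
  refine ⟨fun x => if x = y then n else r x, if_pos rfl, fun x hx => ?_, ?_⟩
  · simp only [e x hx]; exact hr.1 x hx
  · rintro a b (ha | rfl) (hb | rfl) hab
    · simp only [e a ha, e b hb]; exact hr.2 a ha b hb hab
    · simp only [e a ha, if_true]; exact hr.1 a ha
    · exact absurd hab (hS b hb).not_gt
    · exact absurd hab (lt_irrefl _)

/-- Ranks add: with `y₁` at height `n` and `y₂` at height `m`, only the removed point has height `n
+ m`. -/
theorem IsSpherical.puncturedProduct {y₁ : P} {y₂ : Q} {T : Set Q} (hS : IsSpherical A S)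
    (hT : IsSpherical A T) (hSy : ∀ p ∈ S, p < y₁) (hTy : ∀ q ∈ T, q < y₂) :
    IsSpherical A (puncturedProduct y₁ y₂ S T) := by
  obtain ⟨n, ⟨r, hr⟩, hn⟩ := hS
  obtain ⟨m, ⟨s, hs⟩, hm⟩ := hT
  obtain ⟨r, ry, rlt, rmono⟩ := hr.exists_insert_top hSy
  obtain ⟨s, sy, slt, smono⟩ := hs.exists_insert_top hTy
  refine ⟨n + m, ⟨fun x => r x.1 + s x.2, ?_, ?_⟩, fun k hk =>
    exactAt_puncturedProduct hSy hTy hn hm hk⟩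
  · rintro ⟨p, q⟩ ⟨hp | rfl, hq | rfl, hne⟩
    · exact add_lt_add (rlt p hp) (slt q hq)
    · simp only [sy]; have := rlt p hp; omega
    · simp only [ry]; have := slt q hq; omega
    · exact (hne rfl).elim
  · rintro ⟨p, q⟩ ⟨hp, hq, -⟩ ⟨p', q'⟩ ⟨hp', hq', -⟩ h
    have h1 : r p ≤ r p' := (Prod.mk_le_mk.1 h.le).1.eq_or_lt.elim (fun e => e ▸ le_rfl)
      fun h => (rmono _ _ hp hp' h).le
    have h2 : s q ≤ s q' := (Prod.mk_le_mk.1 h.le).2.eq_or_lt.elim (fun e => e ▸ le_rfl)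
      fun h => (smono _ _ hq hq' h).le
    rcases Prod.mk_lt_mk.1 h with h | h
    · have : r p < r p' := rmono _ _ hp hp' h.1
      simp only; omega
    · have : s q < s q' := smono _ _ hq hq' h.2
      simp only; omega

end Spherical

/-! ### Intervals in products -/

section Interval

variable {A : Type v} [CommRing A] {P Q : Type u} [PartialOrder P] [PartialOrder Q]

/-- The open interval from `x` to `y`, where `x` may lie below all of `P`. -/
def openInterval (x : WithBot P) (y : P) : Set P := {z | x < z ∧ z < y}

theorem openInterval_eq_empty {x : WithBot P} {y : P} (h : ¬ x < y) : openInterval x y = ∅ :=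
  Set.eq_empty_of_forall_notMem fun _ hz => h (hz.1.trans (WithBot.coe_lt_coe.2 hz.2))

theorem mem_openInterval_coe {x y z : P} : z ∈ openInterval (x : WithBot P) y ↔ x < z ∧ z < y := by
  simp [openInterval]

/-- When both coordinates increase, the interval is the suspension of the join of the two intervals:
it is covered by two acyclic pieces meeting in that join. The suspension accounts for the extra `1`
in `n + m + 1`. -/
theorem isSpherical_openInterval_prod_of_lt {x₁ y₁ : P} {x₂ y₂ : Q} (h₁ : x₁ < y₁) (h₂ : x₂ < y₂)
    (hP : IsSpherical A (openInterval (x₁ : WithBot P) y₁))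
    (hQ : IsSpherical A (openInterval (x₂ : WithBot Q) y₂)) :
    IsSpherical A (openInterval ((x₁, x₂) : P × Q) (y₁, y₂)) := by
  classical
  obtain ⟨n, ⟨r, hr⟩, hn⟩ := hP
  obtain ⟨m, ⟨s, hs⟩, hm⟩ := hQ
  have hSy : ∀ p ∈ openInterval (x₁ : WithBot P) y₁, p < y₁ := fun _ h => h.2
  have hTy : ∀ q ∈ openInterval (x₂ : WithBot Q) y₂, q < y₂ := fun _ h => h.2
  refine ⟨n + m + 1, ?_, fun k hk => ?_⟩
  · obtain ⟨r, ry, rlt, rmono⟩ := hr.exists_insert_top hSy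
    obtain ⟨s, sy, slt, smono⟩ := hs.exists_insert_top hTy
    let r' : P → ℕ := fun p => if p = x₁ then 0 else r p + 1
    let s' : Q → ℕ := fun q => if q = x₂ then 0 else s q + 1
    have mono_r {a b : P} (ha : x₁ ≤ a) (hb : b ≤ y₁) (hab : a < b) : r' a < r' b := by
      have hxb : x₁ < b := ha.trans_lt hab
      simp only [r', if_neg hxb.ne']
      split_ifs with h
      · omega
      · have hxa : x₁ < a := lt_of_le_of_ne ha (Ne.symm h)
        have := rmono a b (Or.inl (mem_openInterval_coe.2 ⟨hxa, hab.trans_le hb⟩))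
          (hb.lt_or_eq.imp (fun h => mem_openInterval_coe.2 ⟨hxb, h⟩) id) hab
        omega
    have mono_s {a b : Q} (ha : x₂ ≤ a) (hb : b ≤ y₂) (hab : a < b) : s' a < s' b := by
      have hxb : x₂ < b := ha.trans_lt hab
      simp only [s', if_neg hxb.ne']
      split_ifs with h
      · omega
      · have hxa : x₂ < a := lt_of_le_of_ne ha (Ne.symm h)
        have := smono a b (Or.inl (mem_openInterval_coe.2 ⟨hxa, hab.trans_le hb⟩))
          (hb.lt_or_eq.imp (fun h => mem_openInterval_coe.2 ⟨hxb, h⟩) id) hab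
        omega
    have mono {a b : P × Q} (ha : (x₁, x₂) ≤ a) (hb : b ≤ (y₁, y₂)) (hab : a < b) :
        r' a.1 + s' a.2 < r' b.1 + s' b.2 := by
      have h1 : r' a.1 ≤ r' b.1 := hab.le.1.eq_or_lt.elim (fun e => e ▸ le_rfl)
        fun h => (mono_r ha.1 hb.1 h).le
      have h2 : s' a.2 ≤ s' b.2 := hab.le.2.eq_or_lt.elim (fun e => e ▸ le_rfl)
        fun h => (mono_s ha.2 hb.2 h).le
      rcases Prod.lt_iff.1 hab with h | h
      · have := mono_r ha.1 hb.1 h.1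
        omega
      · have := mono_s ha.2 hb.2 h.2
        omega
    have bot : r' x₁ + s' x₂ = 0 := by simp [r', s']
    have top : r' y₁ + s' y₂ = n + m + 2 := by
      simp only [r', s', if_neg h₁.ne', if_neg h₂.ne', ry, sy]
      omega
    -- The sum is `0` at the bottom and `n + m + 2` at the top, so inside it takes values from `1`
    -- to `n + m + 1`, and the subtraction never truncates.
    refine ⟨fun z => r' z.1 + s' z.2 - 1, fun z hz => ?_, fun z hz w hw hzw => ?_⟩
    · rw [mem_openInterval_coe] at hz
      have a1 := mono le_rfl hz.2.le hz.1
      have a2 := mono hz.1.le le_rfl hz.2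
      simp only at a1 a2 ⊢
      omega
    · rw [mem_openInterval_coe] at hz hw
      have a1 := mono le_rfl hz.2.le hz.1
      have a2 := mono hz.1.le hw.2.le hzw
      simp only at a1 a2 ⊢
      omega
  · let S := openInterval (x₁ : WithBot P) y₁
    let T := openInterval (x₂ : WithBot Q) y₂
    have hS {p : P} : p ∈ S ∨ p = y₁ ↔ x₁ < p ∧ p ≤ y₁ := by
      rw [mem_openInterval_coe, le_iff_lt_or_eq]
      constructor
      · rintro (h | rfl)
        · exact ⟨h.1, Or.inl h.2⟩
        · exact ⟨h₁, Or.inr rfl⟩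
      · rintro ⟨h, h' | h'⟩
        · exact Or.inl ⟨h, h'⟩
        · exact Or.inr h'
    have hT {p : Q} : p ∈ T ∨ p = y₂ ↔ x₂ < p ∧ p ≤ y₂ := by
      rw [mem_openInterval_coe, le_iff_lt_or_eq]
      constructor
      · rintro (h | rfl)
        · exact ⟨h.1, Or.inl h.2⟩
        · exact ⟨h₂, Or.inr rfl⟩
      · rintro ⟨h, h' | h'⟩
        · exact Or.inl ⟨h, h'⟩
        · exact Or.inr h'
    have hS' {p : P} : p ∈ Set.Ico x₁ y₁ ∨ p = y₁ ↔ x₁ ≤ p ∧ p ≤ y₁ := by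
      rw [Set.mem_Ico, le_iff_lt_or_eq (a := p)]
      constructor
      · rintro (h | rfl)
        · exact ⟨h.1, Or.inl h.2⟩
        · exact ⟨h₁.le, Or.inr rfl⟩
      · rintro ⟨h, h' | h'⟩
        · exact Or.inl ⟨h, h'⟩
        · exact Or.inr h'
    have hT' {p : Q} : p ∈ Set.Ico x₂ y₂ ∨ p = y₂ ↔ x₂ ≤ p ∧ p ≤ y₂ := by
      rw [Set.mem_Ico, le_iff_lt_or_eq (a := p)]
      constructor
      · rintro (h | rfl)
        · exact ⟨h.1, Or.inl h.2⟩
        · exact ⟨h₂.le, Or.inr rfl⟩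
      · rintro ⟨h, h' | h'⟩
        · exact Or.inl ⟨h, h'⟩
        · exact Or.inr h'
    have mU {z : P × Q} : z ∈ openInterval ((x₁, x₂) : P × Q) (y₁, y₂) ↔
        (x₁ < z.1 ∨ x₂ < z.2) ∧ (x₁ ≤ z.1 ∧ z.1 ≤ y₁) ∧ (x₂ ≤ z.2 ∧ z.2 ≤ y₂) ∧
          z ≠ (y₁, y₂) := by
      rw [mem_openInterval_coe, lt_iff_le_and_ne (a := z), Prod.lt_iff, Prod.le_def]
      constructor
      · rintro ⟨h | h, h', h''⟩
        · exact ⟨Or.inl h.1, ⟨h.1.le, h'.1⟩, ⟨h.2, h'.2⟩, h''⟩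
        · exact ⟨Or.inr h.2, ⟨h.1, h'.1⟩, ⟨h.2.le, h'.2⟩, h''⟩
      · rintro ⟨h | h, h1, h2, h3⟩
        · exact ⟨Or.inl ⟨h, h2.1⟩, ⟨h1.2, h2.2⟩, h3⟩
        · exact ⟨Or.inr ⟨h1.1, h⟩, ⟨h1.2, h2.2⟩, h3⟩
    -- The pieces are the points whose first, respectively second, coordinate exceeds that of `(x₁,
    -- x₂)`.
    refine exactAt_of_cover (U₁ := puncturedProduct y₁ y₂ S (Set.Ico x₂ y₂))
      (U₂ := puncturedProduct y₁ y₂ (Set.Ico x₁ y₁) T) (U₀ := puncturedProduct y₁ y₂ S T)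
      ?_ ?_ ?_ ?_ ?_ ?_ ?_
    · rintro z ⟨h1, h2, h3⟩
      rw [hS] at h1
      rw [hT'] at h2
      exact mU.2 ⟨Or.inl h1.1, ⟨h1.1.le, h1.2⟩, h2, h3⟩
    · rintro z ⟨h1, h2, h3⟩
      rw [hS'] at h1
      rw [hT] at h2
      exact mU.2 ⟨Or.inr h2.1, h1, ⟨h2.1.le, h2.2⟩, h3⟩
    · ext z
      simp only [puncturedProduct, Set.mem_inter_iff, Set.mem_ofPred_eq, hS, hT, hS', hT']
      constructor
      · rintro ⟨h1, h2, h3⟩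
        exact ⟨⟨h1, ⟨h2.1.le, h2.2⟩, h3⟩, ⟨h1.1.le, h1.2⟩, h2, h3⟩
      · rintro ⟨⟨h1, -, h3⟩, -, h2, -⟩
        exact ⟨h1, h2, h3⟩
    · intro l hl hmem
      cases l with
      | nil => simp
      | cons a l =>
        have hal := (List.pairwise_cons.1 hl).1
        have ha := mU.1 (hmem a (by simp))
        have hle : ∀ z ∈ a :: l, a ≤ z := fun z hz =>
          (List.mem_cons.1 hz).elim (fun e => e ▸ le_rfl) (hal z)
        -- A chain lies in whichever piece contains its least entry, since both pieces are closed
        -- upwards.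
        refine ha.1.imp (fun h z hz => ?_) (fun h z hz => ?_)
        · have hz' := mU.1 (hmem z hz)
          exact ⟨hS.2 ⟨h.trans_le (hle z hz).1, hz'.2.1.2⟩, hT'.2 hz'.2.2.1, hz'.2.2.2⟩
        · have hz' := mU.1 (hmem z hz)
          exact ⟨hS'.2 hz'.2.1, hT.2 ⟨h.trans_le (hle z hz).2, hz'.2.2.1.2⟩, hz'.2.2.2⟩
    -- The half-open interval has a least element and is exact in all degrees; `b = k + 1` is just
    -- large enough.
    · exact exactAt_puncturedProduct (T := Set.Ico x₂ y₂) (b := k + 1) hSy (fun q hq => hq.2) hn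
        (fun j _ => exactAt_of_isLeast (isLeast_Ico h₂) j) (by omega)
    · exact exactAt_puncturedProduct (S := Set.Ico x₁ y₁) (a := k + 1) (fun q hq => hq.2) hTy
        (fun j _ => exactAt_of_isLeast (isLeast_Ico h₁) j) hm (by omega)
    · intro j hj
      exact exactAt_puncturedProduct hSy hTy hn hm (by omega)

/-- Unless both coordinates strictly increase from an actual lower end, the interval is itself a
punctured product. If, say, `x₁ = y₁`, the first factor is empty and only `{y₁} × (x₂, y₂)` remains.
-/
theorem isSpherical_openInterval_prod (hP : ∀ x (y : P), IsSpherical A (openInterval x y))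
    (hQ : ∀ x (y : Q), IsSpherical A (openInterval x y)) (x : WithBot (P × Q)) (y : P × Q) :
    IsSpherical A (openInterval x y) := by
  obtain ⟨y₁, y₂⟩ := y
  have key (a : WithBot P) (b : WithBot Q) :
      IsSpherical A (puncturedProduct y₁ y₂ (openInterval a y₁) (openInterval b y₂)) :=
    (hP a y₁).puncturedProduct (hQ b y₂) (fun _ h => h.2) (fun _ h => h.2)
  induction x with
  | bot =>
    convert key ⊥ ⊥ using 1
    ext z
    have h {R : Type u} [PartialOrder R] (a b : R) : a ∈ openInterval ⊥ b ↔ a < b := by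
      simp [openInterval]
    rw [h, lt_iff_le_and_ne, Prod.le_def, le_iff_lt_or_eq, le_iff_lt_or_eq, ← h, ← h, and_assoc]
    rfl
  | coe x =>
    obtain ⟨x₁, x₂⟩ := x
    by_cases hxy : (x₁, x₂) < (y₁, y₂)
    swap
    · rw [openInterval_eq_empty (by rwa [WithBot.coe_lt_coe])]
      exact isSpherical_empty
    have hle := Prod.mk_le_mk.1 hxy.le
    rcases hle.1.eq_or_lt with rfl | h₁
    · convert key x₁ x₂ using 1
      ext ⟨p, q⟩
      simp only [mem_openInterval_coe, puncturedProduct, Set.mem_ofPred_eq]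
      constructor
      · rintro ⟨h, h'⟩
        obtain rfl : x₁ = p := le_antisymm (Prod.mk_le_mk.1 h.le).1 (Prod.mk_le_mk.1 h'.le).1
        rw [Prod.mk_lt_mk_iff_right] at h h'
        exact ⟨Or.inr rfl, Or.inl ⟨h, h'⟩, fun e => h'.ne (congrArg Prod.snd e)⟩
      · rintro ⟨h | rfl, h' | rfl, hne⟩
        · exact absurd h.1 h.2.not_gt
        · exact absurd h.1 h.2.not_gt
        · exact ⟨Prod.mk_lt_mk_iff_right.2 h'.1, Prod.mk_lt_mk_iff_right.2 h'.2⟩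
        · exact absurd rfl hne
    rcases hle.2.eq_or_lt with rfl | h₂
    · convert key x₁ x₂ using 1
      ext ⟨p, q⟩
      simp only [mem_openInterval_coe, puncturedProduct, Set.mem_ofPred_eq]
      constructor
      · rintro ⟨h, h'⟩
        obtain rfl : x₂ = q := le_antisymm (Prod.mk_le_mk.1 h.le).2 (Prod.mk_le_mk.1 h'.le).2
        rw [Prod.mk_lt_mk_iff_left] at h h'
        exact ⟨Or.inl ⟨h, h'⟩, Or.inr rfl, fun e => h'.ne (congrArg Prod.fst e)⟩
      · rintro ⟨h | rfl, h' | rfl, hne⟩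
        · exact absurd h'.1 h'.2.not_gt
        · exact ⟨Prod.mk_lt_mk_iff_left.2 h.1, Prod.mk_lt_mk_iff_left.2 h.2⟩
        · exact absurd h'.1 h'.2.not_gt
        · exact absurd rfl hne
    exact isSpherical_openInterval_prod_of_lt h₁ h₂ (hP _ _) (hQ _ _)

/-! ### Order isomorphisms -/

theorem IsChainList.map (e : P ≃o Q) {S : Set P} {k : ℕ} {l : List P}
    (h : IsChainList (· ≤ ·) S k l) : IsChainList (· ≤ ·) (e '' S) k (l.map e) := by
  refine ⟨by rw [List.length_map, h.1], ?_, ?_⟩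
  · rw [List.pairwise_map]
    exact h.2.imp fun h => e.le_iff_le.2 h
  · intro x hx
    obtain ⟨y, hy, rfl⟩ := List.mem_map.1 hx
    exact ⟨y, h.3 y hy, rfl⟩

/-- The map induced on lists by an order isomorphism. -/
def listMap (A : Type v) [CommRing A] (e : P ≃o Q) : ListModule A P →ₗ[A] ListModule A Q :=
  Finsupp.lmapDomain A A (List.map e)

@[simp] theorem listMap_single (e : P ≃o Q) (l : List P) :
    listMap A e (Finsupp.single l 1) = Finsupp.single (l.map e) 1 := by simp [listMap]

theorem listMap_mem (e : P ≃o Q) {S : Set P} {k : ℕ} {u : ListModule A P}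
    (hu : u ∈ chains A (· ≤ ·) S k) : listMap A e u ∈ chains A (· ≤ ·) (e '' S) k :=
  map_mem_of_chains (fun l hl => by
    rw [listMap_single]; exact single_mem_chains (hl.map e)) hu

theorem listMap_symm_listMap (e : P ≃o Q) (u : ListModule A P) :
    listMap A e.symm (listMap A e u) = u := by
  have : listMap A e.symm ∘ₗ listMap A e = LinearMap.id :=
    ListModule.hom_ext fun l => by simp [Function.comp_def]
  exact LinearMap.congr_fun this u

theorem del_listMap (e : P ≃o Q) (u : ListModule A P) :
    del (listMap A e u) = listMap A e (del u) := by
  have : del ∘ₗ listMap A e = listMap A e ∘ₗ del := by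
    refine ListModule.hom_ext fun l => ?_
    simp only [LinearMap.comp_apply, listMap_single, del_single]
    induction l with
    | nil => simp
    | cons a l ih =>
      have hc (u : ListModule A P) : listMap A e (consMap a u) = consMap (e a) (listMap A e u) := by
        have : listMap A e ∘ₗ consMap a = consMap (e a) ∘ₗ listMap A e :=
          ListModule.hom_ext fun l => by simp
        exact LinearMap.congr_fun this u
      rw [List.map_cons, listBoundary_cons, listBoundary_cons, ih, map_sub, hc, listMap_single]
  exact LinearMap.congr_fun this u

theorem IsSpherical.image (e : P ≃o Q) {S : Set P} (h : IsSpherical A S) :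
    IsSpherical A (e '' S) := by
  obtain ⟨n, ⟨r, hr⟩, hn⟩ := h
  refine ⟨n, ⟨r ∘ e.symm, ?_, ?_⟩, fun k hk z hz hdz => ?_⟩
  · rintro _ ⟨x, hx, rfl⟩
    simpa using hr.1 x hx
  · rintro _ ⟨x, hx, rfl⟩ _ ⟨y, hy, rfl⟩ hxy
    simpa using hr.2 x hx y hy (e.lt_iff_lt.1 hxy)
  · have h1 := listMap_mem e.symm hz
    rw [← Set.image_comp, show (e.symm : Q → P) ∘ e = id from funext e.symm_apply_apply,
      Set.image_id] at h1
    obtain ⟨w, hw, ew⟩ := hn k hk _ h1 (by rw [del_listMap, hdz, map_zero])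
    refine ⟨listMap A e w, listMap_mem e hw, ?_⟩
    rw [del_listMap, ew]
    exact listMap_symm_listMap e.symm z

theorem isSpherical_openInterval_of_orderIso (e : P ≃o Q)
    (hP : ∀ x (y : P), IsSpherical A (openInterval x y)) (x : WithBot Q) (y : Q) :
    IsSpherical A (openInterval x y) := by
  obtain ⟨x', hx'⟩ : ∃ x' : WithBot P, ∀ z : P, x' < z ↔ x < e z := by
    induction x with
    | bot => exact ⟨⊥, fun z => by simp⟩
    | coe x => exact ⟨(e.symm x : P), fun z => by simp [e.symm_apply_lt]⟩
  convert (hP x' (e.symm y)).image e using 1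
  ext z
  constructor
  · rintro ⟨h1, h2⟩
    exact ⟨e.symm z, ⟨(hx' _).2 (by simpa using h1), e.symm.lt_iff_lt.2 h2⟩, by simp⟩
  · rintro ⟨z, ⟨h1, h2⟩, rfl⟩
    exact ⟨(hx' z).1 h1, (e.lt_symm_apply).1 h2⟩

end Interval

/-! ### Cohen-Macaulay posets with a greatest element -/

section CohenMacaulay

variable {A : Type v} [CommRing A] {P : Type u} [PartialOrder P]

/-- The numbers of elements of the chains in `S`. -/
def chainCards (S : Set P) : Set ℕ :=
  {m | ∃ C : Finset S, IsChain (· ≤ ·) (C : Set S) ∧ C.card = m}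

theorem posetLength_eq (S : Set P) : posetLength S = (sSup (chainCards S) : ℕ) - 1 := rfl

theorem bddAbove_chainCards [Finite P] (S : Set P) : BddAbove (chainCards S) := by
  have := Fintype.ofFinite S
  refine ⟨Fintype.card S, ?_⟩
  rintro _ ⟨C, -, rfl⟩
  exact C.card_le_univ

/-- The rank of `x` is the largest size of a chain of `S` strictly below `x`; adjoining `x` to such
a chain gives both inequalities. -/
theorem exists_isRank [Finite P] (S : Set P) : ∃ r, IsRank S (sSup (chainCards S)) r := by
  classical
  let D (x : P) : Set ℕ :=
    {m | ∃ C : Finset S, (IsChain (· ≤ ·) (C : Set S) ∧ ∀ c ∈ C, (c : P) < x) ∧ C.card = m}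
  have hD (x) : D x ⊆ chainCards S := fun m ⟨C, hC, e⟩ => ⟨C, hC.1, e⟩
  have hbdd (x) : BddAbove (D x) := (bddAbove_chainCards S).mono (hD x)
  have hmem (x) : sSup (D x) ∈ D x := Nat.sSup_mem ⟨0, ∅, by simp, rfl⟩ (hbdd x)
  have hins {x : P} (hx : x ∈ S) : ∃ C : Finset S, IsChain (· ≤ ·) (C : Set S) ∧
      (∀ c ∈ C, (c : P) ≤ x) ∧ C.card = sSup (D x) + 1 := by
    obtain ⟨C, ⟨hC, hCx⟩, e⟩ := hmem x
    refine ⟨insert ⟨x, hx⟩ C, ?_, ?_, ?_⟩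
    · rw [Finset.coe_insert]
      exact hC.insert fun b hb _ => Or.inr (hCx b hb).le
    · intro c hc
      rcases Finset.mem_insert.1 hc with rfl | hc
      · exact le_rfl
      · exact (hCx c hc).le
    · rw [Finset.card_insert_of_notMem fun h => (hCx _ h).false, e]
  refine ⟨fun x => sSup (D x), fun x hx => ?_, fun x hx y _ hxy => ?_⟩
  · obtain ⟨C, hC, -, e⟩ := hins hx
    exact Nat.lt_of_succ_le (le_csSup (bddAbove_chainCards S) ⟨C, hC, e⟩)
  · obtain ⟨C, hC, hCx, e⟩ := hins hx
    exact Nat.lt_of_succ_le (le_csSup (hbdd y) ⟨C, ⟨hC, fun c hc => (hCx c hc).trans_lt hxy⟩, e⟩)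

theorem IsRank.card_le {S : Set P} {n : ℕ} {r : P → ℕ} (hr : IsRank S n r) {m : ℕ}
    (hm : m ∈ chainCards S) : m ≤ n := by
  obtain ⟨C, hC, rfl⟩ := hm
  rw [← Finset.card_range n]
  refine Finset.card_le_card_of_injOn (fun c => r c)
    (fun c _ => Finset.mem_coe.2 (Finset.mem_range.2 (hr.1 c c.2))) ?_
  intro a ha b hb hab
  by_contra hne
  rcases hC ha hb hne with h | h
  · exact (hr.2 a a.2 b b.2 (lt_of_le_of_ne h fun e => hne (Subtype.ext e))).ne hab
  · exact (hr.2 b b.2 a a.2 (lt_of_le_of_ne h fun e => hne (Subtype.ext e.symm))).ne' hab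

theorem mem_chainCards {S : Set P} {k : ℕ} {l : List P} (hl : IsChainList (· < ·) S k l) :
    k ∈ chainCards S := by
  obtain ⟨s, -⟩ := exists_chainToList_eq S hl
  refine ⟨Finset.univ.map s.toEmbedding, ?_, by simp⟩
  rintro a ha b hb -
  simp only [Finset.coe_map, Finset.coe_univ, Set.image_univ, Set.mem_range] at ha hb
  obtain ⟨i, rfl⟩ := ha
  obtain ⟨j, rfl⟩ := hb
  exact (le_total i j).imp s.monotone.imp s.monotone.imp

/-- The bound `n` need not be attained by a chain. If homology survives at `k`, then `n ≤ k` and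
some strict chain has `k` elements, while the rank allows at most `n`; so `k` is the maximal chain
size. -/
theorem IsSpherical.isZero {S : Set P} (h : IsSpherical A S) {k : ℕ}
    (hk : (k : ℤ) - 1 ≠ posetLength S) : CategoryTheory.Limits.IsZero (reducedHomology A S k) := by
  rw [isZero_reducedHomology_iff]
  obtain ⟨n, ⟨r, hr⟩, hn⟩ := h
  by_contra hex
  have hnk : n ≤ k := not_lt.1 fun h => hex (hn k h)
  rw [← exactAt_lt_iff] at hex
  obtain ⟨l, hl⟩ : ∃ l, IsChainList (· < ·) S k l := by
    by_contra! hcon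
    exact hex (exactAt_of_no_chains hcon)
  have hkmem := mem_chainCards hl
  have hle : ∀ m ∈ chainCards S, m ≤ k := fun m hm => (hr.card_le hm).trans hnk
  apply hk
  rw [posetLength_eq, le_antisymm (csSup_le ⟨k, hkmem⟩ hle) (le_csSup ⟨k, hle⟩ hkmem)]

theorem isSpherical_of_isZero [Finite P] {S : Set P} (h : ∀ k : ℕ, (k : ℤ) - 1 ≠ posetLength S →
    CategoryTheory.Limits.IsZero (reducedHomology A S k)) : IsSpherical A S := by
  refine ⟨_, exists_isRank S, fun k hk => ?_⟩
  rw [← isZero_reducedHomology_iff]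
  refine h k ?_
  rw [posetLength_eq]
  omega

theorem mem_link {C : Set P} (hC : IsChain (· ≤ ·) C) {z : P} :
    z ∈ link C ↔ z ∉ C ∧ ∀ c ∈ C, z ≤ c ∨ c ≤ z := by
  refine and_congr_right fun hz => ⟨fun h c hc => ?_, fun h => hC.insert fun b hb _ => h b hb⟩
  exact h (Set.mem_insert _ _) (Set.mem_insert_of_mem _ hc) fun e => hz (e ▸ hc)

/-- The interval is a link: take a maximal chain among those that contain `y`, and `x` if it is not
`⊥`, and avoid the interval. -/
theorem IsCohenMacaulay.isSpherical_openInterval [Finite P] (h : IsCohenMacaulay A P)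
    (x : WithBot P) (y : P) : IsSpherical A (openInterval x y) := by
  by_cases hxy : x < y
  swap
  · rw [openInterval_eq_empty hxy]
    exact isSpherical_empty
  let 𝒞 : Set (Set P) := {C | IsChain (· ≤ ·) C ∧ ∀ z ∈ C, (z : WithBot P) ≤ x ∨ y ≤ z}
  have h0 : {z : P | (z : WithBot P) = x ∨ z = y} ∈ 𝒞 := by
    refine ⟨?_, ?_⟩
    · rintro a (rfl | rfl) b (hb | rfl) hab
      · exact absurd (WithBot.coe_injective hb).symm hab
      · exact Or.inl (WithBot.coe_lt_coe.1 hxy).le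
      · subst hb
        exact Or.inr (WithBot.coe_lt_coe.1 hxy).le
      · exact absurd rfl hab
    · rintro a (h | rfl)
      · exact Or.inl h.le
      · exact Or.inr le_rfl
  obtain ⟨C, hC0, ⟨hC, hCD⟩, hmax⟩ := (Set.toFinite 𝒞).exists_le_maximal h0
  have hin {z : P} (hz : (z : WithBot P) ≤ x ∨ y ≤ z) (hcomp : ∀ c ∈ C, z ≤ c ∨ c ≤ z) : z ∈ C :=
    hmax (y := insert z C) ⟨hC.insert fun b hb _ => hcomp b hb, fun w hw => by
      rcases Set.mem_insert_iff.1 hw with rfl | hw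
      · exact hz
      · exact hCD w hw⟩ (Set.subset_insert z C) (Set.mem_insert z C)
  have hlink : link C = openInterval x y := by
    ext z
    rw [mem_link hC]
    constructor
    · rintro ⟨hz, hcomp⟩
      have hy : ¬ y ≤ z := fun h => hz (hin (Or.inr h) hcomp)
      have hx : ¬ (z : WithBot P) ≤ x := fun h => hz (hin (Or.inl h) hcomp)
      refine ⟨?_, ?_⟩
      · induction x with
        | bot => exact WithBot.bot_lt_coe z
        | coe x =>
          rw [WithBot.coe_le_coe] at hx
          rw [WithBot.coe_lt_coe]
          have h' := (hcomp x (hC0 (Or.inl rfl))).resolve_left hx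
          exact lt_of_le_of_ne h' fun e => hx e.ge
      · have h' := (hcomp y (hC0 (Or.inr rfl))).resolve_right hy
        exact lt_of_le_of_ne h' fun e => hy e.ge
    · rintro ⟨hx, hy⟩
      refine ⟨fun hz => (hCD z hz).elim hx.not_ge hy.not_ge, fun c hc => ?_⟩
      rcases hCD c hc with h | h
      · exact Or.inr (WithBot.coe_le_coe.1 (h.trans hx.le))
      · exact Or.inl (hy.le.trans h)
  rw [← hlink]
  exact isSpherical_of_isZero (h C hC)

/-- With `c` the greatest element of `C`, this set is the ordinal sum of the part below `c`, treated
by induction, and the interval `(c, y)`. -/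
theorem isSpherical_link_below (h : ∀ x (y : P), IsSpherical A (openInterval x y)) {C : Set P}
    (hfin : C.Finite) (hC : IsChain (· ≤ ·) C) (y : P) (hy : ∀ c ∈ C, c < y) :
    IsSpherical A ({z | z < y} ∩ link C) := by
  induction hn : C.ncard generalizing C y with
  | zero =>
    obtain rfl := (Set.ncard_eq_zero hfin).1 hn
    convert h ⊥ y using 1
    ext z
    simp [openInterval, mem_link hC]
  | succ n ih =>
    have hne : C.Nonempty := Set.nonempty_of_ncard_ne_zero (by omega)
    obtain ⟨c, hc, hmax⟩ := hfin.exists_maximal hne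
    have hle : ∀ d ∈ C, d ≤ c := fun d hd => (hC.total hd hc).elim id (hmax hd)
    have hC' : IsChain (· ≤ ·) (C \ {c}) := hC.mono Set.sdiff_subset
    have hlt : ∀ d ∈ C \ {c}, d < c := fun d hd => lt_of_le_of_ne (hle d hd.1) hd.2
    have key := (ih (hfin.subset Set.sdiff_subset) hC' c hlt (by
      rw [Set.ncard_sdiff_singleton_of_mem hc, hn]; rfl)).union (h c y)
        (fun a ha b hb => (show a < c from ha.1).trans (mem_openInterval_coe.1 hb).1)
    convert key using 1
    ext z
    simp only [Set.mem_inter_iff, Set.mem_union, mem_link hC, mem_link hC', mem_openInterval_coe,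
      Set.mem_ofPred_eq]
    constructor
    · rintro ⟨hzy, hz, hcomp⟩
      have hzc : z ≠ c := fun e => hz (e ▸ hc)
      rcases hcomp c hc with h' | h'
      · exact Or.inl ⟨lt_of_le_of_ne h' hzc, fun h => hz h.1, fun d hd => hcomp d hd.1⟩
      · exact Or.inr ⟨lt_of_le_of_ne h' hzc.symm, hzy⟩
    · rintro (⟨hzc, hz, hcomp⟩ | ⟨hcz, hzy⟩)
      · refine ⟨hzc.trans (hy c hc), fun h => hz ⟨h, hzc.ne⟩, fun d hd => ?_⟩
        by_cases e : d = c
        · exact Or.inl (e ▸ hzc.le)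
        · exact hcomp d ⟨hd, e⟩
      · exact ⟨hzy, fun h => (hle z h).not_gt hcz, fun d hd => Or.inr ((hle d hd).trans hcz.le)⟩

/-- If `t ∈ C`, the link is an ordinal sum of intervals; otherwise `t` is the greatest element of
the link, which is then acyclic. -/
theorem isCohenMacaulay_of_isSpherical_openInterval [Finite P] {t : P} (ht : IsTop t)
    (h : ∀ x (y : P), IsSpherical A (openInterval x y)) : IsCohenMacaulay A P := by
  intro C hC k hk
  by_cases htC : t ∈ C
  · have hlt {z : P} (hz : z ≠ t) : z < t := lt_of_le_of_ne (ht z) hz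
    have key := isSpherical_link_below h (Set.toFinite (C \ {t})) (hC.mono Set.sdiff_subset) t
      fun c hc => hlt hc.2
    have e : link C = {z | z < t} ∩ link (C \ {t}) := by
      ext z
      simp only [Set.mem_inter_iff, mem_link hC, mem_link (hC.mono Set.sdiff_subset),
        Set.mem_ofPred_eq]
      constructor
      · rintro ⟨hz, hcomp⟩
        exact ⟨hlt fun e => hz (e ▸ htC), fun h => hz h.1, fun d hd => hcomp d hd.1⟩
      · rintro ⟨hzt, hz, hcomp⟩
        refine ⟨fun h => hz ⟨h, hzt.ne⟩, fun d hd => ?_⟩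
        by_cases e : d = t
        · exact Or.inl (e ▸ hzt.le)
        · exact hcomp d ⟨hd, e⟩
    rw [← e] at key
    exact key.isZero hk
  · rw [isZero_reducedHomology_iff]
    exact exactAt_of_isGreatest
      ⟨(mem_link hC).2 ⟨htC, fun c _ => Or.inr (ht c)⟩, fun z _ => ht z⟩ k

/-- The product of two finite Cohen-Macaulay posets with greatest elements is Cohen-Macaulay. -/
theorem IsCohenMacaulay.of_orderIso_prod {Q R : Type u} [PartialOrder Q] [PartialOrder R] [Finite P]
    [Finite Q] [Finite R] (e : P × Q ≃o R) {p : P} {q : Q} (hp : IsTop p) (hq : IsTop q)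
    (hP : IsCohenMacaulay A P) (hQ : IsCohenMacaulay A Q) : IsCohenMacaulay A R :=
  isCohenMacaulay_of_isSpherical_openInterval (t := e (p, q))
    (fun z => by rw [← e.apply_symm_apply z, e.le_iff_le]; exact ⟨hp _, hq _⟩)
    (isSpherical_openInterval_of_orderIso e (isSpherical_openInterval_prod
      hP.isSpherical_openInterval hQ.isSpherical_openInterval))

theorem isCohenMacaulay_of_subsingleton [Finite P] [Subsingleton P] [Nonempty P] :
    IsCohenMacaulay A P :=
  isCohenMacaulay_of_isSpherical_openInterval (t := Classical.arbitrary P)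
    (fun _ => (Subsingleton.elim _ _).le) fun x y => by
      have : openInterval x y = ∅ := Set.eq_empty_of_forall_notMem fun z hz =>
        hz.2.ne (Subsingleton.elim _ _)
      rw [this]
      exact isSpherical_empty

end CohenMacaulay

/-! ### Reflection cosets: least eigenspace, restriction, product decomposition -/

section Groups

variable {V : Type u} [AddCommGroup V] [Module ℂ V]

open Module

/-! ### Reflection cosets -/

theorem IsReflectionCoset.exists_mul_eq {G : Subgroup (LinearMap.GeneralLinearGroup ℂ V)}
    {γ : LinearMap.GeneralLinearGroup ℂ V} (h : IsReflectionCoset G γ)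
    {g : LinearMap.GeneralLinearGroup ℂ V} (hg : g ∈ G) : ∃ g' ∈ G, g * γ = γ * g' := by
  have : g * γ ∈ γ • (G : Set (LinearMap.GeneralLinearGroup ℂ V)) := by
    rw [h.coset_eq]
    exact ⟨g, hg, rfl⟩
  obtain ⟨g', hg', e⟩ := this
  exact ⟨g', hg', e.symm⟩

theorem IsReflectionCoset.exists_mul_eq' {G : Subgroup (LinearMap.GeneralLinearGroup ℂ V)}
    {γ : LinearMap.GeneralLinearGroup ℂ V} (h : IsReflectionCoset G γ)
    {g : LinearMap.GeneralLinearGroup ℂ V} (hg : g ∈ G) : ∃ g' ∈ G, γ * g = g' * γ := by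
  have : γ * g ∈ MulOpposite.op γ • (G : Set (LinearMap.GeneralLinearGroup ℂ V)) := by
    rw [← h.coset_eq]
    exact ⟨g, hg, rfl⟩
  obtain ⟨g', hg', e⟩ := this
  exact ⟨g', hg', e.symm⟩

/-- `γ` normalizes `G`, so `⟨G, γ⟩` is the product set of two finite groups. Finiteness permits
averaging and Maschke's theorem. -/
theorem IsReflectionCoset.finite_sup {G : Subgroup (LinearMap.GeneralLinearGroup ℂ V)}
    {γ : LinearMap.GeneralLinearGroup ℂ V} (h : IsReflectionCoset G γ) :
    Finite (G ⊔ Subgroup.zpowers γ : Subgroup (LinearMap.GeneralLinearGroup ℂ V)) := by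
  have : Finite G := h.isUnitaryReflectionGroup.finite
  have hz : Finite (Subgroup.zpowers γ) := h.isOfFinOrder.finite_zpowers
  have hn : Subgroup.zpowers γ ≤ Subgroup.normalizer (G : Set _) := by
    rw [Subgroup.zpowers_le, Subgroup.mem_normalizer_iff]
    intro g
    constructor
    · intro hg
      obtain ⟨g', hg', e⟩ := h.exists_mul_eq' hg
      rwa [e, mul_inv_cancel_right]
    · intro hg
      obtain ⟨g', hg', e⟩ := h.exists_mul_eq hg
      rw [inv_mul_cancel_right] at e
      rwa [mul_left_cancel e]
  have : ((G ⊔ Subgroup.zpowers γ : Subgroup _) :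
      Set (LinearMap.GeneralLinearGroup ℂ V)).Finite := by
    rw [Subgroup.coe_mul_of_right_le_normalizer_left _ _ hn]
    exact (Set.toFinite _).mul (Set.toFinite _)
  exact this.to_subtype

theorem mem_eigenspace {x : LinearMap.GeneralLinearGroup ℂ V} {ζ : ℂ} {v : V} :
    v ∈ eigenspace x ζ ↔ (x : End ℂ V) v = ζ • v := End.mem_eigenspace_iff

theorem mem_eigenspaceSet {ζ : ℂ} {G : Subgroup (LinearMap.GeneralLinearGroup ℂ V)}
    {γ : LinearMap.GeneralLinearGroup ℂ V} {E : Submodule ℂ V} :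
    E ∈ eigenspaceSet ζ G γ ↔ ∃ g ∈ G, eigenspace (γ * g) ζ = E := by
  constructor
  · rintro ⟨_, ⟨g, hg, rfl⟩, e⟩
    exact ⟨g, hg, e⟩
  · rintro ⟨g, hg, e⟩
    exact ⟨_, ⟨g, hg, rfl⟩, e⟩

@[simp] theorem inv_apply_apply (g : LinearMap.GeneralLinearGroup ℂ V) (v : V) :
    ((g⁻¹ : LinearMap.GeneralLinearGroup ℂ V) : End ℂ V) ((g : End ℂ V) v) = v := by
  rw [← End.mul_apply, Units.inv_mul, End.one_apply]

@[simp] theorem apply_inv_apply (g : LinearMap.GeneralLinearGroup ℂ V) (v : V) :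
    (g : End ℂ V) (((g⁻¹ : LinearMap.GeneralLinearGroup ℂ V) : End ℂ V) v) = v := by
  rw [← End.mul_apply, Units.mul_inv, End.one_apply]

/-! ### Invariant hermitian forms and the smallest eigenspace -/

/-- The standard inner product in some basis, summed over the translates by `K`. -/
theorem exists_invariant_form [FiniteDimensional ℂ V]
    (K : Subgroup (LinearMap.GeneralLinearGroup ℂ V)) [Finite K] :
    ∃ B : V →ₗ⋆[ℂ] V →ₗ[ℂ] ℂ, (∀ u v, starRingEnd ℂ (B u v) = B v u) ∧
      (∀ v, B v v = 0 → v = 0) ∧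
      ∀ k ∈ K, ∀ u v, B ((k : End ℂ V) u) ((k : End ℂ V) v) = B u v := by
  have := Fintype.ofFinite K
  let e : V ≃ₗ[ℂ] EuclideanSpace ℂ (Fin (finrank ℂ V)) :=
    LinearEquiv.ofFinrankEq _ _ (by simp)
  let f (k : K) (v : V) := e (((k : LinearMap.GeneralLinearGroup ℂ V) : End ℂ V) v)
  refine ⟨LinearMap.mk₂'ₛₗ (starRingEnd ℂ) (RingHom.id ℂ)
    (fun u v => ∑ k : K, inner ℂ (f k u) (f k v)) ?_ ?_ ?_ ?_, ?_, ?_, ?_⟩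
  · intro a b c
    simp [f, Finset.sum_add_distrib]
  · intro c a b
    simp [f, Finset.mul_sum, mul_comm]
  · intro a b c
    simp [f, Finset.sum_add_distrib]
  · intro c a b
    simp [f, Finset.mul_sum]
  · intro u v
    simp only [LinearMap.mk₂'ₛₗ_apply, map_sum, inner_conj_symm]
  · intro v hv
    simp only [LinearMap.mk₂'ₛₗ_apply, inner_self_eq_norm_sq_to_K] at hv
    have hv' : ∑ k : K, ‖f k v‖ ^ 2 = 0 := Complex.ofReal_eq_zero.1 (by push_cast; exact hv)
    rw [Finset.sum_eq_zero_iff_of_nonneg fun _ _ => by positivity] at hv'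
    have h1 := hv' 1 (Finset.mem_univ _)
    simpa [f] using h1
  · intro k hk u v
    simp only [LinearMap.mk₂'ₛₗ_apply]
    refine Fintype.sum_equiv (Equiv.mulRight (⟨k, hk⟩ : K)) _ _ fun x => ?_
    simp [f]

theorem IsReflection.finrank_range [FiniteDimensional ℂ V]
    {s : LinearMap.GeneralLinearGroup ℂ V} (hs : IsReflection s) :
    finrank ℂ (LinearMap.range ((s : End ℂ V) - 1)) = 1 := by
  have h1 := LinearMap.finrank_range_add_finrank_ker ((s : End ℂ V) - 1)
  have h2 : LinearMap.ker ((s : End ℂ V) - 1) = eigenspace s 1 := by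
    ext v
    simp [sub_eq_zero]
  have h3 := hs.2
  rw [h2] at h1
  omega

theorem IsReflection.exists_smul_eq [FiniteDimensional ℂ V]
    {s : LinearMap.GeneralLinearGroup ℂ V} (hs : IsReflection s) {v : V}
    (hv : (s : End ℂ V) v ≠ v) (w : V) :
    ∃ c : ℂ, c • ((s : End ℂ V) v - v) = (s : End ℂ V) w - w := by
  have h := (finrank_eq_one_iff_of_nonzero'
    (⟨((s : End ℂ V) - 1) v, v, rfl⟩ : LinearMap.range ((s : End ℂ V) - 1)) (by
      intro h
      exact hv (sub_eq_zero.1 (congrArg Subtype.val h)))).1 hs.finrank_range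
  obtain ⟨c, hc⟩ := h ⟨((s : End ℂ V) - 1) w, w, rfl⟩
  exact ⟨c, congrArg Subtype.val hc⟩

/-- Let `s x v = ζ v` and `w = s⁻¹ v`, so `x v = ζ w`. Invariance and `|ζ| = 1` make `f` orthogonal
to `v - w = s w - w`. If this were nonzero it would span the range of `s - 1`, making `f` orthogonal
to `s f - f` and forcing `s f = f`. Hence `s v = v` and `x v = ζ v`; the inclusion is strict because
of `f`. -/
theorem IsReflection.eigenspace_mul_lt [FiniteDimensional ℂ V]
    (K : Subgroup (LinearMap.GeneralLinearGroup ℂ V)) [Finite K]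
    {s x : LinearMap.GeneralLinearGroup ℂ V} (hs : IsReflection s) (hsK : s ∈ K) (hxK : x ∈ K)
    {ζ : ℂ} (hζ : ‖ζ‖ = 1) {f : V} (hf : f ∈ eigenspace x ζ) (hsf : (s : End ℂ V) f ≠ f) :
    eigenspace (s * x) ζ < eigenspace x ζ := by
  obtain ⟨B, hconj, hpos, hinv⟩ := exists_invariant_form K
  rw [mem_eigenspace] at hf
  have hζ0 : ζ ≠ 0 := by
    rintro rfl
    simp at hζ
  have key : ∀ v ∈ eigenspace (s * x) ζ, (s : End ℂ V) v = v ∧ v ∈ eigenspace x ζ := by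
    intro v hv
    rw [mem_eigenspace, Units.val_mul, End.mul_apply] at hv
    set w := ((s⁻¹ : LinearMap.GeneralLinearGroup ℂ V) : End ℂ V) v with hw
    have hsw : (s : End ℂ V) w = v := apply_inv_apply s v
    have hxv : (x : End ℂ V) v = ζ • w := by
      rw [hw, ← map_smul, ← hv, inv_apply_apply]
    suffices hvw : v = w by
      rw [← hvw] at hsw hxv
      exact ⟨hsw, mem_eigenspace.2 hxv⟩
    by_contra hne
    have hfd : B f (v - w) = 0 := by
      have h1 := hinv x hxK f v
      rw [hf, hxv, LinearMap.map_smulₛₗ₂, map_smul, smul_eq_mul, smul_eq_mul, ← mul_assoc,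
        Complex.conj_mul', hζ] at h1
      simp only [Complex.ofReal_one, one_pow, one_mul] at h1
      rw [map_sub, h1, sub_self]
    obtain ⟨c, hc⟩ := hs.exists_smul_eq (v := w) (by rw [hsw]; exact hne) f
    rw [hsw] at hc
    set r := (s : End ℂ V) f - f with hr
    have hfr : B f r = 0 := by rw [← hc, map_smul, hfd, smul_zero]
    have e1 : B f ((s : End ℂ V) f) = B f f := by
      rwa [hr, map_sub, sub_eq_zero] at hfr
    have e2 : B ((s : End ℂ V) f) f = B f f := by rw [← hconj, e1, hconj]
    -- Expanding `B (s f - f) (s f - f)`, all four terms equal `B f f` up to sign.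
    have hrr : B r r = 0 := by
      rw [hr, LinearMap.map_sub₂, map_sub, map_sub, hinv s hsK, e1, e2]
      simp
    exact hsf (sub_eq_zero.1 (hpos r hrr))
  refine lt_of_le_of_ne (fun v hv => (key v hv).2) fun e => hsf ?_
  exact (key f (e ▸ mem_eigenspace.2 hf)).1

/-- An eigenspace of least dimension is fixed pointwise by every reflection of `G`, since otherwise
multiplying by that reflection would shrink it. So it is fixed by `G` and lies in every `V(γg', ζ)`.
-/
theorem IsReflectionCoset.exists_isTop [FiniteDimensional ℂ V]
    {G : Subgroup (LinearMap.GeneralLinearGroup ℂ V)} {γ : LinearMap.GeneralLinearGroup ℂ V}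
    (h : IsReflectionCoset G γ) {ζ : ℂ} (hζ : ‖ζ‖ = 1) :
    ∃ t : EigenspacePoset ζ G γ, IsTop t := by
  have := h.finite_sup
  have : Finite G := h.isUnitaryReflectionGroup.finite
  obtain ⟨g, hg, hmin⟩ := Set.exists_min_image (G : Set (LinearMap.GeneralLinearGroup ℂ V))
    (fun g => finrank ℂ (eigenspace (γ * g) ζ)) (Set.toFinite _) ⟨1, G.one_mem⟩
  have hγ : γ ∈ G ⊔ Subgroup.zpowers γ := Subgroup.mem_sup_right (Subgroup.mem_zpowers γ)
  have hfix : ∀ s ∈ G, ∀ f ∈ eigenspace (γ * g) ζ, (s : End ℂ V) f = f := by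
    intro s hs
    rw [← h.isUnitaryReflectionGroup.generated] at hs
    induction hs using Subgroup.closure_induction with
    | mem s hs =>
      intro f hf
      by_contra hne
      -- `s γ g = γ s' g` stays in the coset, so minimality applies to it.
      obtain ⟨s', hs', e⟩ := h.exists_mul_eq hs.1
      have hlt := Submodule.finrank_lt_finrank_of_lt (hs.2.eigenspace_mul_lt _
        (Subgroup.mem_sup_left hs.1) (mul_mem hγ (Subgroup.mem_sup_left hg)) hζ hf hne)
      rw [← mul_assoc, e, mul_assoc] at hlt
      exact hlt.not_ge (hmin _ (mul_mem hs' hg))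
    | one => simp
    | mul a b _ _ ha hb =>
      intro f hf
      rw [Units.val_mul, End.mul_apply, hb f hf, ha f hf]
    | inv a _ ha =>
      intro f hf
      nth_rewrite 1 [← ha f hf]
      exact inv_apply_apply a f
  refine ⟨OrderDual.toDual ⟨_, mem_eigenspaceSet.2 ⟨g, hg, rfl⟩⟩, ?_⟩
  rintro ⟨E, hE⟩
  obtain ⟨g', hg', rfl⟩ := mem_eigenspaceSet.1 hE
  change eigenspace (γ * g) ζ ≤ eigenspace (γ * g') ζ
  intro f hf
  have e1 := hfix _ (mul_mem (inv_mem hg) hg') f hf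
  have : γ * g' = γ * g * (g⁻¹ * g') := by group
  rw [mem_eigenspace, this, Units.val_mul, End.mul_apply, e1]
  exact mem_eigenspace.1 hf

/-! ### Restriction to a subrepresentation -/

variable {G : Subgroup (LinearMap.GeneralLinearGroup ℂ V)} {γ : LinearMap.GeneralLinearGroup ℂ V}

/-- The action of `⟨G, γ⟩` on a subrepresentation. -/
def restrictHom (σ : Subrepresentation (naturalRepresentation G γ)) :
    (G ⊔ Subgroup.zpowers γ : Subgroup (LinearMap.GeneralLinearGroup ℂ V)) →*
      LinearMap.GeneralLinearGroup ℂ σ.toSubmodule :=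
  MonoidHom.toHomUnits σ.toRepresentation

theorem apply_mem (σ : Subrepresentation (naturalRepresentation G γ))
    {k : LinearMap.GeneralLinearGroup ℂ V} (hk : k ∈ G ⊔ Subgroup.zpowers γ) {w : V}
    (hw : w ∈ σ.toSubmodule) : (k : End ℂ V) w ∈ σ.toSubmodule :=
  σ.apply_mem_toSubmodule ⟨k, hk⟩ hw

theorem mem_sup_of_mem {g : LinearMap.GeneralLinearGroup ℂ V} (hg : g ∈ G) :
    g ∈ G ⊔ Subgroup.zpowers γ := Subgroup.mem_sup_left hg

variable (G γ) in
/-- `γ` as an element of `⟨G, γ⟩`. -/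
def generator : (G ⊔ Subgroup.zpowers γ : Subgroup (LinearMap.GeneralLinearGroup ℂ V)) :=
  ⟨γ, Subgroup.mem_sup_right (Subgroup.mem_zpowers γ)⟩

/-- The action of `G` on a subrepresentation. -/
def restrictGroup (σ : Subrepresentation (naturalRepresentation G γ)) :
    Subgroup (LinearMap.GeneralLinearGroup ℂ σ.toSubmodule) :=
  (G.subgroupOf _).map (restrictHom σ)

theorem mem_restrictGroup {σ : Subrepresentation (naturalRepresentation G γ)}
    {x : LinearMap.GeneralLinearGroup ℂ σ.toSubmodule} :
    x ∈ restrictGroup σ ↔ ∃ (g : _) (hg : g ∈ G), restrictHom σ ⟨g, mem_sup_of_mem hg⟩ = x := by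
  constructor
  · rintro ⟨⟨g, hgK⟩, hg, rfl⟩
    exact ⟨g, hg, rfl⟩
  · rintro ⟨g, hg, rfl⟩
    exact ⟨⟨g, mem_sup_of_mem hg⟩, hg, rfl⟩

/-- The range of the restriction of `s - 1` sits inside the line `range (s - 1)`, and is nonzero
when the restriction is not the identity. -/
theorem isReflection_restrictHom [FiniteDimensional ℂ V]
    (σ : Subrepresentation (naturalRepresentation G γ))
    (s : (G ⊔ Subgroup.zpowers γ : Subgroup (LinearMap.GeneralLinearGroup ℂ V)))
    (hs : IsReflection (s : LinearMap.GeneralLinearGroup ℂ V)) (h1 : restrictHom σ s ≠ 1) :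
    IsReflection (restrictHom σ s) := by
  refine ⟨MonoidHom.isOfFinOrder _ (Submonoid.isOfFinOrder_coe.1 hs.1), ?_⟩
  set x := restrictHom σ s with hx
  have e1 := LinearMap.finrank_range_add_finrank_ker ((x : End ℂ σ.toSubmodule) - 1)
  have e2 : LinearMap.ker ((x : End ℂ σ.toSubmodule) - 1) = eigenspace x 1 := by
    ext v
    simp [sub_eq_zero]
  have hle : finrank ℂ (LinearMap.range ((x : End ℂ σ.toSubmodule) - 1)) ≤ 1 := by
    rw [← hs.finrank_range, ← Submodule.finrank_map_subtype_eq]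
    refine Submodule.finrank_mono ?_
    rintro _ ⟨_, ⟨w, rfl⟩, rfl⟩
    exact ⟨w, rfl⟩
  have hne : finrank ℂ (LinearMap.range ((x : End ℂ σ.toSubmodule) - 1)) ≠ 0 := by
    rw [Ne, Submodule.finrank_eq_zero, LinearMap.range_eq_bot, sub_eq_zero]
    exact fun h => h1 (Units.ext h)
  rw [e2] at e1
  omega

theorem IsReflectionCoset.restrict [FiniteDimensional ℂ V] (h : IsReflectionCoset G γ)
    (σ : Subrepresentation (naturalRepresentation G γ)) :
    IsReflectionCoset (restrictGroup σ) (restrictHom σ (generator G γ)) := by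
  have : Finite G := h.isUnitaryReflectionGroup.finite
  refine ⟨⟨?_, le_antisymm ?_ ?_⟩, ?_, ?_⟩
  · have := h.finite_sup
    have : ((restrictGroup σ : Subgroup _) :
        Set (LinearMap.GeneralLinearGroup ℂ σ.toSubmodule)).Finite :=
      (Set.toFinite _).image _
    exact this.to_subtype
  · rw [Subgroup.closure_le]
    exact fun x hx => hx.1
  · intro x hx
    obtain ⟨g, hg, rfl⟩ := mem_restrictGroup.1 hx
    have hg' := hg
    rw [← h.isUnitaryReflectionGroup.generated] at hg'
    -- Quantifying over the membership proof lets the closure induction change `g`.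
    have key : ∀ hK : g ∈ G ⊔ Subgroup.zpowers γ, restrictHom σ ⟨g, hK⟩ ∈
        Subgroup.closure {x | x ∈ restrictGroup σ ∧ IsReflection x} := by
      clear hx hg
      have hGK : Subgroup.closure {g | g ∈ G ∧ IsReflection g} ≤ G ⊔ Subgroup.zpowers γ := by
        rw [h.isUnitaryReflectionGroup.generated]
        exact le_sup_left
      induction hg' using Subgroup.closure_induction with
      | mem s hs =>
        intro hK
        by_cases h1 : restrictHom σ ⟨s, hK⟩ = 1
        · rw [h1]
          exact one_mem _
        · exact Subgroup.subset_closure ⟨mem_restrictGroup.2 ⟨s, hs.1, rfl⟩,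
            isReflection_restrictHom σ ⟨s, hK⟩ hs.2 h1⟩
      | one =>
        intro hK
        rw [show (⟨1, hK⟩ : (G ⊔ Subgroup.zpowers γ : Subgroup _)) = 1 from rfl, map_one]
        exact one_mem _
      | mul a b ha hb iha ihb =>
        intro hK
        have : (⟨a * b, hK⟩ : (G ⊔ Subgroup.zpowers γ : Subgroup _)) =
          ⟨a, hGK ha⟩ * ⟨b, hGK hb⟩ := rfl
        rw [this, map_mul]
        exact mul_mem (iha _) (ihb _)
      | inv a ha iha =>
        intro hK
        have : (⟨a⁻¹, hK⟩ : (G ⊔ Subgroup.zpowers γ : Subgroup _)) = ⟨a, hGK ha⟩⁻¹ := rfl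
        rw [this, map_inv]
        exact inv_mem (iha _)
    exact key _
  · exact MonoidHom.isOfFinOrder _ (Submonoid.isOfFinOrder_coe.1 h.isOfFinOrder)
  · ext x
    constructor
    · rintro ⟨y, hy, rfl⟩
      obtain ⟨g, hg, rfl⟩ := mem_restrictGroup.1 hy
      obtain ⟨g', hg', e⟩ := h.exists_mul_eq' hg
      refine ⟨_, mem_restrictGroup.2 ⟨g', hg', rfl⟩, ?_⟩
      have e' : generator G γ * ⟨g, mem_sup_of_mem hg⟩ = ⟨g', mem_sup_of_mem hg'⟩ * generator G γ :=
        Subtype.ext e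
      simpa using congrArg (restrictHom σ) e'.symm
    · rintro ⟨y, hy, rfl⟩
      obtain ⟨g, hg, rfl⟩ := mem_restrictGroup.1 hy
      obtain ⟨g', hg', e⟩ := h.exists_mul_eq hg
      refine ⟨_, mem_restrictGroup.2 ⟨g', hg', rfl⟩, ?_⟩
      have e' : ⟨g, mem_sup_of_mem hg⟩ * generator G γ = generator G γ * ⟨g', mem_sup_of_mem hg'⟩ :=
        Subtype.ext e
      simpa using congrArg (restrictHom σ) e'.symm

/-! ### Decomposition along complementary subrepresentations -/

/-- If `s` moved a vector of `σ` and one of `τ`, the line `range (s - 1)` would lie in both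
subspaces. -/
theorem IsReflection.eq_or_eq [FiniteDimensional ℂ V]
    {σ τ : Subrepresentation (naturalRepresentation G γ)}
    (hd : Disjoint σ.toSubmodule τ.toSubmodule) {s : LinearMap.GeneralLinearGroup ℂ V}
    (hs : IsReflection s) (hsK : s ∈ G ⊔ Subgroup.zpowers γ) :
    (∀ w ∈ σ.toSubmodule, (s : End ℂ V) w = w) ∨ ∀ w ∈ τ.toSubmodule, (s : End ℂ V) w = w := by
  by_contra! hcon
  obtain ⟨⟨a, ha, hsa⟩, b, hb, hsb⟩ := hcon
  obtain ⟨c, hc⟩ := hs.exists_smul_eq hsa b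
  have h1 : (s : End ℂ V) b - b ∈ σ.toSubmodule :=
    hc ▸ Submodule.smul_mem _ _ (sub_mem (apply_mem σ hsK ha) ha)
  have h2 : (s : End ℂ V) b - b ∈ τ.toSubmodule := sub_mem (apply_mem τ hsK hb) hb
  exact hsb (sub_eq_zero.1 (Submodule.disjoint_def.1 hd _ h1 h2))

/-- For a reflection take `k = 1` or `k = s`, according to the summand on which it is trivial. The
property passes to products and inverses because `σ` is stable. -/
theorem IsReflectionCoset.exists_extend_one [FiniteDimensional ℂ V] (h : IsReflectionCoset G γ)
    {σ τ : Subrepresentation (naturalRepresentation G γ)}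
    (hd : Disjoint σ.toSubmodule τ.toSubmodule) {g : LinearMap.GeneralLinearGroup ℂ V}
    (hg : g ∈ G) : ∃ k ∈ G, (∀ w ∈ σ.toSubmodule, (k : End ℂ V) w = (g : End ℂ V) w) ∧
      ∀ w ∈ τ.toSubmodule, (k : End ℂ V) w = w := by
  have hGK : Subgroup.closure {g | g ∈ G ∧ IsReflection g} ≤ G ⊔ Subgroup.zpowers γ := by
    rw [h.isUnitaryReflectionGroup.generated]
    exact le_sup_left
  rw [← h.isUnitaryReflectionGroup.generated] at hg
  induction hg using Subgroup.closure_induction with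
  | mem s hs =>
    rcases hs.2.eq_or_eq hd (mem_sup_of_mem hs.1) with h1 | h1
    · exact ⟨1, one_mem _, fun w hw => by rw [h1 w hw]; rfl, fun w _ => rfl⟩
    · exact ⟨s, hs.1, fun w _ => rfl, h1⟩
  | one => exact ⟨1, one_mem _, fun w _ => rfl, fun w _ => rfl⟩
  | mul a b ha hb iha ihb =>
    obtain ⟨k, hk, k1, k2⟩ := iha
    obtain ⟨l, hl, l1, l2⟩ := ihb
    refine ⟨k * l, mul_mem hk hl, fun w hw => ?_, fun w hw => ?_⟩
    · rw [Units.val_mul, Units.val_mul, End.mul_apply, End.mul_apply, l1 w hw,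
        k1 _ (apply_mem σ (hGK hb) hw)]
    · rw [Units.val_mul, End.mul_apply, l2 w hw, k2 w hw]
  | inv a ha iha =>
    obtain ⟨k, hk, k1, k2⟩ := iha
    refine ⟨k⁻¹, inv_mem hk, fun w hw => ?_, fun w hw => ?_⟩
    · have := k1 _ (apply_mem σ (inv_mem (hGK ha)) hw)
      rw [apply_inv_apply] at this
      nth_rewrite 1 [← this]
      exact inv_apply_apply k _
    · nth_rewrite 1 [← k2 w hw]
      exact inv_apply_apply k w

theorem IsReflectionCoset.exists_extend [FiniteDimensional ℂ V] (h : IsReflectionCoset G γ)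
    {σ τ : Subrepresentation (naturalRepresentation G γ)}
    (hd : Disjoint σ.toSubmodule τ.toSubmodule) {g₁ g₂ : LinearMap.GeneralLinearGroup ℂ V}
    (hg₁ : g₁ ∈ G) (hg₂ : g₂ ∈ G) :
    ∃ k ∈ G, (∀ w ∈ σ.toSubmodule, (k : End ℂ V) w = (g₁ : End ℂ V) w) ∧
      ∀ w ∈ τ.toSubmodule, (k : End ℂ V) w = (g₂ : End ℂ V) w := by
  obtain ⟨k, hk, k1, k2⟩ := h.exists_extend_one hd hg₁
  obtain ⟨l, hl, l1, l2⟩ := h.exists_extend_one hd.symm hg₂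
  refine ⟨k * l, mul_mem hk hl, fun w hw => ?_, fun w hw => ?_⟩
  · rw [Units.val_mul, End.mul_apply, l2 w hw, k1 w hw]
  · rw [Units.val_mul, End.mul_apply, l1 w hw, k2 _ (apply_mem τ (mem_sup_of_mem hg₂) hw)]

/-- The sum of a subspace of `σ` and a subspace of `τ`. -/
def sumMap (σ τ : Subrepresentation (naturalRepresentation G γ)) (E : Submodule ℂ σ.toSubmodule)
    (F : Submodule ℂ τ.toSubmodule) : Submodule ℂ V :=
  E.map σ.toSubmodule.subtype ⊔ F.map τ.toSubmodule.subtype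

theorem sumMap_le_iff {σ τ : Subrepresentation (naturalRepresentation G γ)}
    (hd : Disjoint σ.toSubmodule τ.toSubmodule) {E E' : Submodule ℂ σ.toSubmodule}
    {F F' : Submodule ℂ τ.toSubmodule} :
    sumMap σ τ E F ≤ sumMap σ τ E' F' ↔ E ≤ E' ∧ F ≤ F' := by
  constructor
  · intro hle
    refine ⟨fun x hx => ?_, fun x hx => ?_⟩
    · have hmem : (x : V) ∈ sumMap σ τ E' F' :=
        hle (Submodule.mem_sup_left (Submodule.mem_map_of_mem hx))
      obtain ⟨_, ⟨y, hy, rfl⟩, _, ⟨z, hz, rfl⟩, e⟩ := Submodule.mem_sup.1 hmem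
      simp only [Submodule.subtype_apply] at e
      have h0 : (z : V) = 0 := Submodule.disjoint_def.1 hd _
        (by rw [eq_sub_of_add_eq' e]; exact sub_mem x.2 y.2) z.2
      rw [h0, add_zero] at e
      rwa [← Subtype.ext e]
    · have hmem : (x : V) ∈ sumMap σ τ E' F' :=
        hle (Submodule.mem_sup_right (Submodule.mem_map_of_mem hx))
      obtain ⟨_, ⟨y, hy, rfl⟩, _, ⟨z, hz, rfl⟩, e⟩ := Submodule.mem_sup.1 hmem
      simp only [Submodule.subtype_apply] at e
      have h0 : (y : V) = 0 := Submodule.disjoint_def.1 hd _ y.2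
        (by rw [eq_sub_of_add_eq e]; exact sub_mem x.2 z.2)
      rw [h0, zero_add] at e
      rwa [← Subtype.ext e]
  · rintro ⟨h1, h2⟩
    exact sup_le_sup (Submodule.map_mono h1) (Submodule.map_mono h2)

theorem eigenspace_eq_sumMap {σ τ : Subrepresentation (naturalRepresentation G γ)}
    (hc : IsCompl σ.toSubmodule τ.toSubmodule)
    (x y z : (G ⊔ Subgroup.zpowers γ : Subgroup (LinearMap.GeneralLinearGroup ℂ V)))
    (hy : ∀ w ∈ σ.toSubmodule, ((x : LinearMap.GeneralLinearGroup ℂ V) : End ℂ V) w =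
      ((y : LinearMap.GeneralLinearGroup ℂ V) : End ℂ V) w)
    (hz : ∀ w ∈ τ.toSubmodule, ((x : LinearMap.GeneralLinearGroup ℂ V) : End ℂ V) w =
      ((z : LinearMap.GeneralLinearGroup ℂ V) : End ℂ V) w) (ζ : ℂ) :
    eigenspace (x : LinearMap.GeneralLinearGroup ℂ V) ζ =
      sumMap σ τ (eigenspace (restrictHom σ y) ζ) (eigenspace (restrictHom τ z) ζ) := by
  refine le_antisymm (fun v hv => ?_) (sup_le ?_ ?_)
  · rw [mem_eigenspace] at hv
    obtain ⟨a, ha, b, hb, rfl⟩ := Submodule.mem_sup.1 (hc.sup_eq_top ▸ Submodule.mem_top : v ∈ _)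
    rw [map_add, smul_add, hy a ha, hz b hb] at hv
    have hya := apply_mem σ y.2 ha
    have hzb := apply_mem τ z.2 hb
    have e := sub_eq_sub_iff_add_eq_add.2 (hv.trans (add_comm _ _))
    -- The eigenvector equation equates a vector of `σ` with one of `τ`, so both vanish and each
    -- component is an eigenvector.
    have h0 := Submodule.disjoint_def.1 hc.disjoint _
      (sub_mem hya (Submodule.smul_mem _ ζ ha))
      (by
        have : ((y : LinearMap.GeneralLinearGroup ℂ V) : End ℂ V) a - ζ • a =
            ζ • b - ((z : LinearMap.GeneralLinearGroup ℂ V) : End ℂ V) b := by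
          rw [sub_eq_sub_iff_add_eq_add, hv, add_comm]
        rw [this]
        exact sub_mem (Submodule.smul_mem _ ζ hb) hzb)
    have h1 := sub_eq_zero.1 h0
    rw [h1, add_right_inj] at hv
    exact Submodule.add_mem_sup
      ⟨⟨a, ha⟩, mem_eigenspace.2 (Subtype.ext h1), rfl⟩
      ⟨⟨b, hb⟩, mem_eigenspace.2 (Subtype.ext hv), rfl⟩
  · rintro _ ⟨w, hw, rfl⟩
    have h1 := congrArg Subtype.val (mem_eigenspace.1 hw)
    exact mem_eigenspace.2 ((hy w w.2).trans h1)
  · rintro _ ⟨w, hw, rfl⟩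
    have h1 := congrArg Subtype.val (mem_eigenspace.1 hw)
    exact mem_eigenspace.2 ((hz w w.2).trans h1)

theorem coe_generator_mul {g : LinearMap.GeneralLinearGroup ℂ V} (hg : g ∈ G) :
    ((generator G γ * ⟨g, mem_sup_of_mem hg⟩ : (G ⊔ Subgroup.zpowers γ : Subgroup _)) :
      LinearMap.GeneralLinearGroup ℂ V) = γ * g := rfl

theorem eigenspace_mul_eq_sumMap {σ τ : Subrepresentation (naturalRepresentation G γ)}
    (hc : IsCompl σ.toSubmodule τ.toSubmodule) {k g₁ g₂ : LinearMap.GeneralLinearGroup ℂ V}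
    (hk : k ∈ G) (hg₁ : g₁ ∈ G) (hg₂ : g₂ ∈ G)
    (h₁ : ∀ w ∈ σ.toSubmodule, (k : End ℂ V) w = (g₁ : End ℂ V) w)
    (h₂ : ∀ w ∈ τ.toSubmodule, (k : End ℂ V) w = (g₂ : End ℂ V) w) (ζ : ℂ) :
    eigenspace (γ * k) ζ = sumMap σ τ
      (eigenspace (restrictHom σ (generator G γ * ⟨g₁, mem_sup_of_mem hg₁⟩)) ζ)
      (eigenspace (restrictHom τ (generator G γ * ⟨g₂, mem_sup_of_mem hg₂⟩)) ζ) := by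
  rw [← coe_generator_mul hk]
  refine eigenspace_eq_sumMap hc _ _ _ (fun w hw => ?_) (fun w hw => ?_) ζ
  · rw [coe_generator_mul hk, coe_generator_mul hg₁, Units.val_mul, Units.val_mul, End.mul_apply,
      End.mul_apply, h₁ w hw]
  · rw [coe_generator_mul hk, coe_generator_mul hg₂, Units.val_mul, Units.val_mul, End.mul_apply,
      End.mul_apply, h₂ w hw]

theorem mem_eigenspaceSet_restrict {σ : Subrepresentation (naturalRepresentation G γ)} {ζ : ℂ}
    {E : Submodule ℂ σ.toSubmodule} :
    E ∈ eigenspaceSet ζ (restrictGroup σ) (restrictHom σ (generator G γ)) ↔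
      ∃ (g : _) (hg : g ∈ G), eigenspace (restrictHom σ
        (generator G γ * ⟨g, mem_sup_of_mem hg⟩)) ζ = E := by
  rw [mem_eigenspaceSet]
  constructor
  · rintro ⟨x, hx, rfl⟩
    obtain ⟨g, hg, rfl⟩ := mem_restrictGroup.1 hx
    exact ⟨g, hg, by rw [map_mul]⟩
  · rintro ⟨g, hg, rfl⟩
    exact ⟨_, mem_restrictGroup.2 ⟨g, hg, rfl⟩, by rw [map_mul]⟩

theorem IsReflectionCoset.sumMap_mem [FiniteDimensional ℂ V] (h : IsReflectionCoset G γ)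
    {σ τ : Subrepresentation (naturalRepresentation G γ)}
    (hc : IsCompl σ.toSubmodule τ.toSubmodule) {ζ : ℂ} {E : Submodule ℂ σ.toSubmodule}
    {F : Submodule ℂ τ.toSubmodule}
    (hE : E ∈ eigenspaceSet ζ (restrictGroup σ) (restrictHom σ (generator G γ)))
    (hF : F ∈ eigenspaceSet ζ (restrictGroup τ) (restrictHom τ (generator G γ))) :
    sumMap σ τ E F ∈ eigenspaceSet ζ G γ := by
  obtain ⟨g₁, hg₁, rfl⟩ := mem_eigenspaceSet_restrict.1 hE
  obtain ⟨g₂, hg₂, rfl⟩ := mem_eigenspaceSet_restrict.1 hF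
  obtain ⟨k, hk, k1, k2⟩ := h.exists_extend hc.disjoint hg₁ hg₂
  exact mem_eigenspaceSet.2 ⟨k, hk, eigenspace_mul_eq_sumMap hc hk hg₁ hg₂ k1 k2 ζ⟩

/-- Adding subspaces of the summands reflects inclusions by directness. It stays among the
eigenspaces because any two elements of `G` can be realized on `σ` and `τ` by a single one; it is
onto because every `γg` preserves both summands. -/
theorem IsReflectionCoset.exists_orderIso [FiniteDimensional ℂ V] (h : IsReflectionCoset G γ)
    {σ τ : Subrepresentation (naturalRepresentation G γ)}
    (hc : IsCompl σ.toSubmodule τ.toSubmodule) (ζ : ℂ) :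
    Nonempty (EigenspacePoset ζ (restrictGroup σ) (restrictHom σ (generator G γ)) ×
      EigenspacePoset ζ (restrictGroup τ) (restrictHom τ (generator G γ)) ≃o
        EigenspacePoset ζ G γ) := by
  let f : EigenspacePoset ζ (restrictGroup σ) (restrictHom σ (generator G γ)) ×
      EigenspacePoset ζ (restrictGroup τ) (restrictHom τ (generator G γ)) →
        EigenspacePoset ζ G γ := fun p => OrderDual.toDual
    ⟨sumMap σ τ (OrderDual.ofDual p.1).1 (OrderDual.ofDual p.2).1,
      h.sumMap_mem hc (OrderDual.ofDual p.1).2 (OrderDual.ofDual p.2).2⟩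
  have hf (p q) : f p ≤ f q ↔ p ≤ q := sumMap_le_iff hc.disjoint
  refine ⟨RelIso.ofSurjective (OrderEmbedding.ofMapLEIff f hf) ?_⟩
  rintro ⟨E, hE⟩
  obtain ⟨g, hg, rfl⟩ := mem_eigenspaceSet.1 hE
  refine ⟨(OrderDual.toDual ⟨_, mem_eigenspaceSet_restrict.2 ⟨g, hg, rfl⟩⟩,
    OrderDual.toDual ⟨_, mem_eigenspaceSet_restrict.2 ⟨g, hg, rfl⟩⟩), ?_⟩
  exact congrArg OrderDual.toDual (Subtype.ext (eigenspace_mul_eq_sumMap hc hg hg hg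
    (fun _ _ => rfl) (fun _ _ => rfl) ζ).symm)

theorem IsReflectionCoset.exists_isCompl (h : IsReflectionCoset G γ) [Nontrivial V]
    (hirr : ¬ (naturalRepresentation G γ).IsIrreducible) :
    ∃ σ τ : Subrepresentation (naturalRepresentation G γ),
      IsCompl σ.toSubmodule τ.toSubmodule ∧ σ.toSubmodule ≠ ⊤ ∧ τ.toSubmodule ≠ ⊤ := by
  have := h.finite_sup
  -- The group order is nonzero in `ℂ`, as Maschke's theorem requires.
  have hne : NeZero ((Nat.card (G ⊔ Subgroup.zpowers γ : Subgroup _) : ℕ) : ℂ) :=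
    ⟨Nat.cast_ne_zero.2 Nat.card_pos.ne'⟩
  have hnt : Nontrivial (Subrepresentation (naturalRepresentation G γ)) :=
    ⟨⊥, ⊤, fun e => bot_ne_top (congrArg Subrepresentation.toSubmodule e)⟩
  obtain ⟨σ, hσ⟩ : ∃ σ : Subrepresentation (naturalRepresentation G γ), ¬ (σ = ⊥ ∨ σ = ⊤) := by
    by_contra! hcon
    exact hirr ⟨hcon⟩
  rw [not_or] at hσ
  obtain ⟨τ, hτ⟩ := ComplementedLattice.exists_isCompl σ
  refine ⟨σ, τ, IsCompl.of_eq (congrArg Subrepresentation.toSubmodule hτ.inf_eq_bot)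
    (congrArg Subrepresentation.toSubmodule hτ.sup_eq_top),
    fun e => hσ.2 (Subrepresentation.toSubmodule_injective e), fun e => hσ.1 ?_⟩
  have : τ = ⊤ := Subrepresentation.toSubmodule_injective e
  rw [this] at hτ
  exact eq_bot_of_isCompl_top hτ

end Groups

end ReflectionCoset

end

/-! ### The induction on the dimension -/

theorem lemma5p1 (ζ : ℂ) (hζ : ∃ m : ℕ, 0 < m ∧ ζ ^ m = 1)
    (irreducible_case : ∀ (V : Type u) [AddCommGroup V] [Module ℂ V] [FiniteDimensional ℂ V]
      (G : Subgroup (LinearMap.GeneralLinearGroup ℂ V)) (γ : LinearMap.GeneralLinearGroup ℂ V)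
      (h : ReflectionCoset.IsReflectionCoset G γ),
      (ReflectionCoset.naturalRepresentation G γ).IsIrreducible →
      haveI := h.finite_eigenspacePoset ζ
      ReflectionCoset.IsCohenMacaulay ℤ (ReflectionCoset.EigenspacePoset ζ G γ))
    (V : Type u) [AddCommGroup V] [Module ℂ V] [FiniteDimensional ℂ V]
    (G : Subgroup (LinearMap.GeneralLinearGroup ℂ V)) (γ : LinearMap.GeneralLinearGroup ℂ V)
    (h : ReflectionCoset.IsReflectionCoset G γ) :
    haveI := h.finite_eigenspacePoset ζ
    ReflectionCoset.IsCohenMacaulay ℤ (ReflectionCoset.EigenspacePoset ζ G γ) := by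
  obtain ⟨m, hm, hζm⟩ := hζ
  have hnorm : ‖ζ‖ = 1 := Complex.norm_eq_one_of_pow_eq_one hζm hm.ne'
  induction hn : Module.finrank ℂ V using Nat.strong_induction_on generalizing V with
  | _ n ih =>
    have := h.finite_eigenspacePoset ζ
    -- The zero space is not irreducible and is treated directly: its poset is a single point.
    rcases subsingleton_or_nontrivial V with hV | hV
    · have : Nonempty (ReflectionCoset.EigenspacePoset ζ G γ) :=
        ⟨OrderDual.toDual ⟨_, ReflectionCoset.mem_eigenspaceSet.2 ⟨1, one_mem _, rfl⟩⟩⟩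
      have : Subsingleton (ReflectionCoset.EigenspacePoset ζ G γ) :=
        inferInstanceAs (Subsingleton (ReflectionCoset.eigenspaceSet ζ G γ))
      exact ReflectionCoset.isCohenMacaulay_of_subsingleton
    by_cases hirr : (ReflectionCoset.naturalRepresentation G γ).IsIrreducible
    · exact irreducible_case V G γ h hirr
    obtain ⟨σ, τ, hc, hσ, hτ⟩ := h.exists_isCompl hirr
    have hσR := h.restrict σ
    have hτR := h.restrict τ
    have := hσR.finite_eigenspacePoset ζ
    have := hτR.finite_eigenspacePoset ζ
    obtain ⟨e⟩ := h.exists_orderIso hc ζ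
    obtain ⟨p, hp⟩ := hσR.exists_isTop hnorm
    obtain ⟨q, hq⟩ := hτR.exists_isTop hnorm
    exact ReflectionCoset.IsCohenMacaulay.of_orderIso_prod e hp hq
      (ih _ (hn ▸ Submodule.finrank_lt hσ) _ _ _ hσR rfl)
      (ih _ (hn ▸ Submodule.finrank_lt hτ) _ _ _ hτR rfl)
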